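/- Let $M=(M(i,j))_{1\le i,j\le q}$ be a stochastic matrix all of whose entries are strictly positive, and let $\alpha$ be its unique invariant probability vector, $\sum_i\alpha(i)M(i,j)=\alpha(j)$. Put $M^{\mathrm{rev}}(i,j)=\alpha(j)M(j,i)/\alpha(i)$. For probability vectors $p$ on $\{1,\dots,q\}$ let $L(p)=S(p|\alpha)+S(\alpha|p)=\sum_{i}(p(i)-\alpha(i))\log\frac{p(i)}{\alpha(i)}\in[0,\infty]$, where $S(p|\alpha)=\sum_i p(i)\log\frac{p(i)}{\alpha(i)}$ is the relative entropy, and let $$c(M)=\sup_{p}\frac{L(pM^{\mathrm{rev}})}{L(p)},$$ the supremum over all probability vectors $p$, where a ratio is read as $0$ if its denominator is $\infty$ or if $p=\alpha$ (in which case it is $0/0$). For a rooted infinite, locally finite tree $T$ with root $0$, let $T^N$ be the subtree of the vertices at distance at most $N$ from the root, and write $v\to w$ if $w$ is a child of $v$. The tree-indexed Markov chain in equilibrium is the unique probability measure $\mathbb P$ on $\{1,\dots,q\}^T$ such that for every $N$ $$\mathbb P(\sigma_{T^N}=\eta_{T^N})=\alpha(\eta(0))\prod_{v\to w,\ v,w\in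 T^N}M(\eta(v),\eta(w)).$$ A probability measure $\mu$ on $\{1,\dots,q\}^T$ is a Gibbs measure if for every finite set $V$ of vertices, with outer boundary $\partial V$, and every configuration $\eta$, $\mu(\sigma_V=\eta_V\mid\sigma_{V^c})=\mathbb P(\sigma_V=\eta_V\mid\sigma_{\partial V})$ holds $\mu$-almost surely, the right-hand side being the elementary conditional probability. Let $T$ be a Galton--Watson tree, with law $\mathbb Q$, whose offspring distribution is concentrated on $\{1,2,\dots\}$, and let $\mathbb Q(d)$ be the expected number of offspring. If $\mathbb Q(d)\,c(M)<1$, then for $\mathbb Q$-almost every tree $T$ the measure $\mathbb P$ is an extreme point of the convex set of all Gibbs measures, and there is no reconstruction: for every state $s$ and every $\varepsilon>0$, $$\lim_{N\to\infty}\mathbb P\Bigl(\xi:\ \bigl|\mathbb P\bigl(\sigma(0)=s\mid\sigma(v)=\xi(v)\text{ for all }v\text{ at distance }N\text{ from the root}\bigr)-\alpha(s)\bigr|\ge\varepsilon\Bigr)=0.$$ -/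

import Mathlib

open MeasureTheory ProbabilityTheory Filter Topology
open scoped ENNReal NNReal Matrix

namespace TreeBroadcast

/-! ### Symmetrized entropy and the constant of a transition matrix -/

/-- For `x ≥ 0` and `y > 0` (or `x = y = 0`), `x log (x / y) ≥ x - y`. -/
theorem sub_le_mul_log_div {x y : ℝ} (hx : 0 ≤ x) (hy : 0 ≤ y) (h : y = 0 → x = 0) :
    x - y ≤ x * Real.log (x / y) := by
  rcases hx.eq_or_lt with hx0 | hx0
  · subst hx0; simpa using hy
  have hy0 : 0 < y := lt_of_le_of_ne hy fun h0 => hx0.ne' (h h0.symm)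
  have h1 := Real.one_sub_inv_le_log_of_pos (div_pos hx0 hy0)
  have h2 : x * (1 - (x / y)⁻¹) = x - y := by field_simp
  rw [← h2]
  exact mul_le_mul_of_nonneg_left h1 hx

/-- The sum that defines the relative entropy of two probability vectors is nonnegative. -/
theorem sum_mul_log_div_nonneg {q : ℕ} {p a : Fin q → ℝ} (hp : p ∈ stdSimplex ℝ (Fin q))
    (ha : a ∈ stdSimplex ℝ (Fin q)) (h : ∀ i, a i = 0 → p i = 0) :
    0 ≤ ∑ i, p i * Real.log (p i / a i) := by
  have h1 : ∑ i, (p i - a i) ≤ ∑ i, p i * Real.log (p i / a i) :=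
    Finset.sum_le_sum fun i _ => sub_le_mul_log_div (hp.1 i) (ha.1 i) (h i)
  rw [Finset.sum_sub_distrib, hp.2, ha.2, sub_self] at h1
  exact h1

open scoped Classical in
/-- The relative entropy `S(p | a) = ∑ i, p i log (p i / a i)` of probability vectors, with values
in `[0, ∞]`. As usual `0 log 0 = 0`, and the value is `∞` if `p` charges a zero of `a`. Otherwise
the sum is nonnegative by `sum_mul_log_div_nonneg`, so that `ENNReal.ofReal` does not truncate. -/
noncomputable def relEntropy {q : ℕ} (p a : Fin q → ℝ) : ℝ≥0∞ :=
  if ∀ i, a i = 0 → p i = 0 then ENNReal.ofReal (∑ i, p i * Real.log (p i / a i)) else ∞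

/-- The symmetrized entropy `L(p) = S(p | α) + S(α | p)`. -/
noncomputable def symEntropy {q : ℕ} (α p : Fin q → ℝ) : ℝ≥0∞ :=
  relEntropy p α + relEntropy α p

/-- The transition matrix of the reversed chain, `M^rev(i, j) = α(j) M(j, i) / α(i)`. -/
noncomputable def revMatrix {q : ℕ} (α : Fin q → ℝ) (M : Matrix (Fin q) (Fin q) ℝ) :
    Matrix (Fin q) (Fin q) ℝ :=
  Matrix.of fun i j => α j * M j i / α i

/-- The constant `c(M) = sup_p L(p M^rev) / L(p)`, the supremum over all probability vectors.
In `[0, ∞]` one has `0 / 0 = 0`, so that `p = α` does not contribute to the supremum, and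
`x / ∞ = 0`, the value for those `p` that have a zero entry. -/
noncomputable def entropyConst {q : ℕ} (α : Fin q → ℝ) (M : Matrix (Fin q) (Fin q) ℝ) : ℝ≥0∞ :=
  ⨆ p ∈ stdSimplex ℝ (Fin q), symEntropy α (p ᵥ* revMatrix α M) / symEntropy α p

/-! ### Rooted trees and the Galton-Watson measure

A rooted tree is coded by the numbers of children `d v` of the individuals `v` of the Ulam-Harris
tree of finite words of natural numbers. The empty word is the root, and the children of `v` are
`k :: v` with `k < d v`. -/

/-- The word `v` is a vertex of the tree with offspring numbers `d`. -/
def IsVertex (d : List ℕ → ℕ) : List ℕ → Prop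
  | [] => True
  | k :: v => k < d v ∧ IsVertex d v

/-- The vertex set of the tree with offspring numbers `d`. -/
abbrev Vertex (d : List ℕ → ℕ) : Type := {v : List ℕ // IsVertex d v}

/-- The root. -/
def root (d : List ℕ → ℕ) : Vertex d := ⟨[], trivial⟩

/-- The distance of a vertex to the root. -/
def height {d : List ℕ → ℕ} (v : Vertex d) : ℕ := v.1.length

/-- The vertex `w` is a child of the vertex `v`. -/
def IsChild {d : List ℕ → ℕ} (v w : Vertex d) : Prop := ∃ k, w.1 = k :: v.1

theorem isVertex_tail {d : List ℕ → ℕ} : ∀ {v : List ℕ}, IsVertex d v → IsVertex d v.tail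
  | [], _ => trivial
  | _ :: _, h => h.2

/-- The parent of a vertex; the value at the root, which has none, is the root itself. -/
def parent {d : List ℕ → ℕ} (w : Vertex d) : Vertex d := ⟨w.1.tail, isVertex_tail w.2⟩

theorem isChild_parent {d : List ℕ → ℕ} {w : Vertex d} (h : w ≠ root d) : IsChild (parent w) w := by
  obtain ⟨l, hl⟩ := w
  cases l with
  | nil => exact absurd rfl h
  | cons k v => exact ⟨k, rfl⟩

theorem finite_words (d : List ℕ → ℕ) (N : ℕ) :
    {v : List ℕ | IsVertex d v ∧ v.length ≤ N}.Finite := by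
  induction N with
  | zero =>
    refine (Set.finite_singleton ([] : List ℕ)).subset fun v hv => ?_
    simpa using hv.2
  | succ n ih =>
    refine ((Set.finite_singleton ([] : List ℕ)).union
      (ih.biUnion fun v _ => (Set.finite_Iio (d v)).image fun k => k :: v)).subset ?_
    rintro v ⟨hv, hl⟩
    cases v with
    | nil => exact Or.inl rfl
    | cons k u =>
      refine Or.inr (Set.mem_biUnion (x := u) ⟨hv.2, by simpa using hl⟩ ⟨k, hv.1, rfl⟩)

theorem finite_ball (d : List ℕ → ℕ) (N : ℕ) : {v : Vertex d | height v ≤ N}.Finite :=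
  Set.Finite.of_finite_image ((finite_words d N).subset (by
    rintro _ ⟨v, hv, rfl⟩
    exact ⟨v.2, hv⟩)) Subtype.val_injective.injOn

/-- The vertices at distance at most `N` from the root, without the root itself; these are the
lower end points of the edges of the tree truncated at height `N`. -/
noncomputable def nonRootBall (d : List ℕ → ℕ) (N : ℕ) : Finset (Vertex d) :=
  (finite_ball d N).toFinset.erase (root d)

/-- The expected number of offspring. -/
noncomputable def offspringMean (ν : PMF ℕ) : ℝ≥0∞ := ∑' k : ℕ, ν k * (k : ℝ≥0∞)

/-- The Galton-Watson measure with offspring law `ν`: independent offspring numbers with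
law `ν` for all individuals. -/
noncomputable def galtonWatson (ν : PMF ℕ) : Measure (List ℕ → ℕ) :=
  Measure.infinitePi fun _ : List ℕ => ν.toMeasure

/-! ### The tree-indexed Markov chain, Gibbs measures, reconstruction -/

/-- Spin configurations on the tree. -/
abbrev Config (d : List ℕ → ℕ) (q : ℕ) : Type := Vertex d → Fin q

/-- The event that the configuration agrees with `η` on the set `A` of vertices. -/
def agreeOn {d : List ℕ → ℕ} {q : ℕ} (A : Set (Vertex d)) (η : Config d q) : Set (Config d q) :=
  {σ | ∀ v ∈ A, σ v = η v}

/-- `P` is the law of the tree-indexed Markov chain with transition matrix `M` and root law `α`: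
the restriction of `P` to the tree truncated at any height `N` gives to the configuration `η` the
probability `α(η(0)) ∏_{v → w} M(η(v), η(w))`. -/
structure IsTreeChain {q : ℕ} (M : Matrix (Fin q) (Fin q) ℝ) (α : Fin q → ℝ) (d : List ℕ → ℕ)
    (P : Measure (Config d q)) : Prop where
  isProb : IsProbabilityMeasure P
  marginal : ∀ (N : ℕ) (η : Config d q), P (agreeOn {v | height v ≤ N} η) =
    ENNReal.ofReal (α (η (root d)) * ∏ w ∈ nonRootBall d N, M (η (parent w)) (η w))

/-- The outer boundary of a set of vertices. -/
def outerBoundary {d : List ℕ → ℕ} (V : Set (Vertex d)) : Set (Vertex d) :=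
  {w | w ∉ V ∧ ∃ v ∈ V, IsChild v w ∨ IsChild w v}

/-- The Gibbs measures for the finite-volume conditional probabilities of `P`: the probability
measures `μ` such that, for every finite set `V` of vertices and every configuration `η`, the
conditional `μ`-probability of `σ_V = η_V` given the configuration outside `V` is `μ`-almost surely
equal to the elementary conditional `P`-probability of `σ_V = η_V` given the configuration on the
boundary of `V`. -/
def gibbsMeasures {d : List ℕ → ℕ} {q : ℕ} (P : Measure (Config d q)) :
    Set (Measure (Config d q)) :=
  {μ | IsProbabilityMeasure μ ∧ ∀ (V : Finset (Vertex d)) (η : Config d q),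
    μ[(agreeOn (V : Set (Vertex d)) η).indicator (fun _ => (1 : ℝ)) |
        cylinderEvents ((V : Set (Vertex d))ᶜ)] =ᵐ[μ]
      fun σ => (P[|agreeOn (outerBoundary (V : Set (Vertex d))) σ]).real
        (agreeOn (V : Set (Vertex d)) η)}

/-- There is no reconstruction: the conditional law of the state at the root, given the
configuration `ξ` at distance `N` from the root, converges to `α` in `P`-probability when `ξ` is
chosen according to `P` and `N → ∞`. -/
def NoReconstruction {d : List ℕ → ℕ} {q : ℕ} (α : Fin q → ℝ) (P : Measure (Config d q)) : Prop :=
  ∀ (s : Fin q) (ε : ℝ), 0 < ε →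
    Tendsto (fun N : ℕ => P {ξ : Config d q |
      ε ≤ |(P[|agreeOn {v | height v = N} ξ]).real {σ | σ (root d) = s} - α s|}) atTop (𝓝 0)

end TreeBroadcast

open TreeBroadcast

/-!
The information about the root is measured by the symmetrized entropy `L` of the posterior law of
the spin at a vertex `v`, given the spins in a later generation below `v`. The likelihood of these
observations is the product over the children `w` of `v` of the likelihoods of the observations
below `w`. Since `L` is a sum against the difference of two laws of the same mass, the
normalization of the posterior law drops out, and the expectation of `L` under the chain is
*additive* over the children (`integral_symEntropyReal_posterior_succ`). The contribution of the
child `w` is the expectation of `L (p M^rev)`, where `p` is the posterior law at `w`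
(`posterior_mulVec`), which is at most `c(M)` times the expectation of `L p`. By iteration, the
expectation of `L` at `v` is at most a constant times `c(M) ^ k` times the number of descendants in
generation `k + 1` (`integral_symEntropyReal_posterior_le`). One generation must be treated
separately, because a point mass has infinite symmetrized entropy.

The `N`-th generation of a Galton-Watson tree has expected size `Q(d) ^ N`
(`lintegral_card_level`), so that for almost every tree these bounds are summable in `k`, for all
vertices `v` (`ae_summable_pow_mul_card_level`). As `L` dominates the squared distance to `α`, the
posterior laws at all vertices converge to `α` almost surely (`ae_tendsto_posterior`). By the
Markov property, the conditional law of the spins in a ball, given a distant level, is expressed by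
the posterior laws at the vertices on the surface of the ball, and so it converges to the
unconditional law (`ae_tendsto_cond_level`). For the ball of radius `0` this is non-reconstruction.

Extremality needs no tail `σ`-algebra: if `P` is a proper convex combination of a Gibbs measure `μ`
and another one, then `μ` is absolutely continuous with respect to `P`. The `μ`-probability of a
cylinder event over a ball is the `μ`-average of its conditional `P`-probability given a distant
level, and these conditional probabilities converge `μ`-almost surely to the `P`-probability of the
event (`mem_extremePoints_gibbsMeasures`).
-/

namespace TreeBroadcast

/-! ### The symmetrized entropy of positive vectors -/

section Entropy

variable {q : ℕ} {α : Fin q → ℝ} {M : Matrix (Fin q) (Fin q) ℝ}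

/-- The symmetrized entropy `∑ i, (p i - α i) log (p i / α i)` as a real number. It is meaningful
for vectors `p` with positive entries, where it agrees with `symEntropy`. -/
noncomputable def symEntropyReal (α p : Fin q → ℝ) : ℝ :=
  ∑ i, (p i - α i) * Real.log (p i / α i)

theorem symEntropy_eq_ofReal (hα : α ∈ stdSimplex ℝ (Fin q)) (hα_pos : ∀ i, 0 < α i)
    {p : Fin q → ℝ} (hp : p ∈ stdSimplex ℝ (Fin q)) (hp_pos : ∀ i, 0 < p i) :
    symEntropy α p = ENNReal.ofReal (symEntropyReal α p) := by
  have h1 : ∀ i, α i = 0 → p i = 0 := fun i h => absurd h (hα_pos i).ne'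
  have h2 : ∀ i, p i = 0 → α i = 0 := fun i h => absurd h (hp_pos i).ne'
  rw [symEntropy, relEntropy, relEntropy, if_pos h1, if_pos h2,
    ← ENNReal.ofReal_add (sum_mul_log_div_nonneg hp hα h1) (sum_mul_log_div_nonneg hα hp h2),
    ← Finset.sum_add_distrib]
  congr 1
  refine Finset.sum_congr rfl fun i _ => ?_
  rw [Real.log_div (hp_pos i).ne' (hα_pos i).ne', Real.log_div (hα_pos i).ne' (hp_pos i).ne']
  ring

theorem sq_le_sub_mul_log_div {x y : ℝ} (hx : 0 < x) (hy : 0 < y) (hx1 : x ≤ 1) (hy1 : y ≤ 1) :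
    (x - y) ^ 2 ≤ (x - y) * Real.log (x / y) := by
  rcases le_total y x with h | h
  · have h1 := Real.one_sub_inv_le_log_of_pos (div_pos hx hy)
    rw [inv_div] at h1
    have h2 : x - y ≤ 1 - y / x := by
      rw [le_sub_iff_add_le, ← le_sub_iff_add_le', div_le_iff₀ hx]
      nlinarith
    nlinarith
  · have h1 := Real.log_le_sub_one_of_pos (div_pos hx hy)
    have h2 : x / y - 1 ≤ x - y := by
      rw [sub_le_iff_le_add, div_le_iff₀ hy]
      nlinarith
    nlinarith

theorem le_one_of_mem_stdSimplex {p : Fin q → ℝ} (hp : p ∈ stdSimplex ℝ (Fin q)) (i : Fin q) :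
    p i ≤ 1 := by
  rw [← hp.2]
  exact Finset.single_le_sum (fun j _ => hp.1 j) (Finset.mem_univ i)

/-- The symmetrized entropy dominates the squared Euclidean distance. -/
theorem sum_sq_le_symEntropyReal (hα : α ∈ stdSimplex ℝ (Fin q)) (hα_pos : ∀ i, 0 < α i)
    {p : Fin q → ℝ} (hp : p ∈ stdSimplex ℝ (Fin q)) (hp_pos : ∀ i, 0 < p i) :
    ∑ i, (p i - α i) ^ 2 ≤ symEntropyReal α p :=
  Finset.sum_le_sum fun i _ => sq_le_sub_mul_log_div (hp_pos i) (hα_pos i)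
    (le_one_of_mem_stdSimplex hp i) (le_one_of_mem_stdSimplex hα i)

theorem symEntropyReal_nonneg (hα : α ∈ stdSimplex ℝ (Fin q)) (hα_pos : ∀ i, 0 < α i)
    {p : Fin q → ℝ} (hp : p ∈ stdSimplex ℝ (Fin q)) (hp_pos : ∀ i, 0 < p i) :
    0 ≤ symEntropyReal α p :=
  (Finset.sum_nonneg fun _ _ => sq_nonneg _).trans (sum_sq_le_symEntropyReal hα hα_pos hp hp_pos)

/-- An invariant law of a matrix with positive entries is positive. -/
theorem invariant_pos (hM_pos : ∀ i j, 0 < M i j) (hα : α ∈ stdSimplex ℝ (Fin q))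
    (hα_inv : α ᵥ* M = α) (j : Fin q) : 0 < α j := by
  obtain ⟨i, hi⟩ : ∃ i, 0 < α i := by
    by_contra! h
    have h1 := Finset.sum_nonpos fun i (_ : i ∈ Finset.univ) => h i
    rw [hα.2] at h1
    linarith
  rw [← hα_inv]
  exact Finset.sum_pos' (fun k _ => mul_nonneg (hα.1 k) (hM_pos k j).le)
    ⟨i, Finset.mem_univ i, mul_pos hi (hM_pos i j)⟩

theorem sum_mul_apply_of_invariant (hα_inv : α ᵥ* M = α) (j : Fin q) : ∑ i, α i * M i j = α j :=
  congrFun hα_inv j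

theorem vecMul_revMatrix_self (hM_row : ∀ i, ∑ j, M i j = 1) (hα_pos : ∀ i, 0 < α i) :
    α ᵥ* revMatrix α M = α := by
  funext j
  calc ∑ i, α i * (α j * M j i / α i) = ∑ i, α j * M j i :=
        Finset.sum_congr rfl fun i _ => by field_simp [(hα_pos i).ne']
    _ = α j := by rw [← Finset.mul_sum, hM_row, mul_one]

theorem revMatrix_pos (hM_pos : ∀ i j, 0 < M i j) (hα_pos : ∀ i, 0 < α i) (i j : Fin q) :
    0 < revMatrix α M i j :=
  div_pos (mul_pos (hα_pos j) (hM_pos j i)) (hα_pos i)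

theorem revMatrix_row_sum (hα_pos : ∀ i, 0 < α i) (hα_inv : α ᵥ* M = α) (i : Fin q) :
    ∑ j, revMatrix α M i j = 1 := by
  simp only [revMatrix, Matrix.of_apply]
  rw [← Finset.sum_div, sum_mul_apply_of_invariant hα_inv, div_self (hα_pos i).ne']

theorem vecMul_revMatrix_mem (hM_pos : ∀ i j, 0 < M i j) (hα_pos : ∀ i, 0 < α i)
    (hα_inv : α ᵥ* M = α) {p : Fin q → ℝ} (hp : p ∈ stdSimplex ℝ (Fin q)) :
    p ᵥ* revMatrix α M ∈ stdSimplex ℝ (Fin q) := by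
  refine ⟨fun j => ?_, ?_⟩
  · change 0 ≤ ∑ i, p i * revMatrix α M i j
    exact Finset.sum_nonneg fun i _ => mul_nonneg (hp.1 i) (revMatrix_pos hM_pos hα_pos i j).le
  calc ∑ j, ∑ i, p i * revMatrix α M i j = ∑ i, p i * ∑ j, revMatrix α M i j := by
        rw [Finset.sum_comm]; simp_rw [Finset.mul_sum]
    _ = 1 := by simp_rw [revMatrix_row_sum hα_pos hα_inv, mul_one, hp.2]

theorem vecMul_revMatrix_pos (hM_pos : ∀ i j, 0 < M i j) (hα_pos : ∀ i, 0 < α i)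
    {p : Fin q → ℝ} (hp_pos : ∀ i, 0 < p i) (j : Fin q) : 0 < (p ᵥ* revMatrix α M) j :=
  Finset.sum_pos (fun i _ => mul_pos (hp_pos i) (revMatrix_pos hM_pos hα_pos i j))
    ⟨j, Finset.mem_univ j⟩

/-- The defining inequality of `entropyConst`, for positive vectors. If the symmetrized entropy of
`p` vanishes, then `p = α`, so that the convention `0 / 0 = 0` does no harm. -/
theorem symEntropyReal_vecMul_le (hM_pos : ∀ i j, 0 < M i j) (hM_row : ∀ i, ∑ j, M i j = 1)
    (hα : α ∈ stdSimplex ℝ (Fin q)) (hα_inv : α ᵥ* M = α) (hc : entropyConst α M ≠ ∞)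
    {p : Fin q → ℝ} (hp : p ∈ stdSimplex ℝ (Fin q)) (hp_pos : ∀ i, 0 < p i) :
    symEntropyReal α (p ᵥ* revMatrix α M) ≤ (entropyConst α M).toReal * symEntropyReal α p := by
  have hα_pos := invariant_pos hM_pos hα hα_inv
  have hL := symEntropyReal_nonneg hα hα_pos hp hp_pos
  rcases hL.eq_or_lt with h0 | h0
  · have h1 := sum_sq_le_symEntropyReal hα hα_pos hp hp_pos
    rw [← h0] at h1
    have h2 : p = α := by
      have h3 := (Finset.sum_eq_zero_iff_of_nonneg fun i _ => sq_nonneg (p i - α i)).1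
        (le_antisymm h1 (Finset.sum_nonneg fun i _ => sq_nonneg _))
      funext i
      have := h3 i (Finset.mem_univ i)
      nlinarith [pow_eq_zero_iff (two_ne_zero) |>.1 this]
    rw [h2, vecMul_revMatrix_self hM_row hα_pos]
    simp [symEntropyReal]
  · have h1 : symEntropy α (p ᵥ* revMatrix α M) / symEntropy α p ≤ entropyConst α M :=
      le_iSup₂ (f := fun p (_ : p ∈ stdSimplex ℝ (Fin q)) =>
        symEntropy α (p ᵥ* revMatrix α M) / symEntropy α p) p hp
    rw [symEntropy_eq_ofReal hα hα_pos hp hp_pos, symEntropy_eq_ofReal hα hα_pos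
      (vecMul_revMatrix_mem hM_pos hα_pos hα_inv hp) (vecMul_revMatrix_pos hM_pos hα_pos hp_pos),
      ENNReal.div_le_iff (ENNReal.ofReal_pos.2 h0).ne' ENNReal.ofReal_ne_top] at h1
    rw [← ENNReal.ofReal_le_ofReal_iff (mul_nonneg ENNReal.toReal_nonneg hL),
      ENNReal.ofReal_mul ENNReal.toReal_nonneg, ENNReal.ofReal_toReal hc]
    exact h1

/-! ### Posterior laws -/

/-- The posterior law with prior `α` and likelihood `Z`. -/
noncomputable def posterior (α Z : Fin q → ℝ) (s : Fin q) : ℝ := α s * Z s / ∑ t, α t * Z t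

theorem sum_prior_mul_pos (hα : α ∈ stdSimplex ℝ (Fin q)) (hα_pos : ∀ i, 0 < α i)
    {Z : Fin q → ℝ} (hZ : ∀ s, 0 < Z s) : 0 < ∑ t, α t * Z t := by
  refine Finset.sum_pos (fun i _ => mul_pos (hα_pos i) (hZ i)) ?_
  rw [← Finset.card_pos, Finset.card_univ, Fintype.card_fin]
  rcases Nat.eq_zero_or_pos q with rfl | h
  · exact absurd hα.2 (by simp)
  · exact h

theorem posterior_pos (hα : α ∈ stdSimplex ℝ (Fin q)) (hα_pos : ∀ i, 0 < α i)
    {Z : Fin q → ℝ} (hZ : ∀ s, 0 < Z s) (s : Fin q) : 0 < posterior α Z s :=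
  div_pos (mul_pos (hα_pos s) (hZ s)) (sum_prior_mul_pos hα hα_pos hZ)

theorem posterior_mem (hα : α ∈ stdSimplex ℝ (Fin q)) (hα_pos : ∀ i, 0 < α i)
    {Z : Fin q → ℝ} (hZ : ∀ s, 0 < Z s) : posterior α Z ∈ stdSimplex ℝ (Fin q) := by
  refine ⟨fun s => (posterior_pos hα hα_pos hZ s).le, ?_⟩
  simp only [posterior]
  rw [← Finset.sum_div, div_self (sum_prior_mul_pos hα hα_pos hZ).ne']

/-- The normalization of the posterior law does not enter its symmetrized entropy, because both
laws have total mass one. This is what makes the symmetrized entropy additive over the children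
of a vertex. -/
theorem symEntropyReal_posterior (hα : α ∈ stdSimplex ℝ (Fin q)) (hα_pos : ∀ i, 0 < α i)
    {Z : Fin q → ℝ} (hZ : ∀ s, 0 < Z s) :
    symEntropyReal α (posterior α Z) = ∑ s, (posterior α Z s - α s) * Real.log (Z s) := by
  have hn := sum_prior_mul_pos hα hα_pos hZ
  have h1 : ∀ s, Real.log (posterior α Z s / α s) = Real.log (Z s) - Real.log (∑ t, α t * Z t) := by
    intro s
    rw [← Real.log_div (hZ s).ne' hn.ne', posterior]
    congr 1
    field_simp [(hα_pos s).ne', hn.ne']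
  simp only [symEntropyReal, h1, mul_sub]
  rw [Finset.sum_sub_distrib, ← Finset.sum_mul, Finset.sum_sub_distrib,
    (posterior_mem hα hα_pos hZ).2, hα.2, sub_self, zero_mul, sub_zero]

/-- The posterior law at the parent, given data below one child, is the image under the reversed
chain of the posterior law at the child. -/
theorem posterior_mulVec (hα_pos : ∀ i, 0 < α i) (hα_inv : α ᵥ* M = α) (Z : Fin q → ℝ) :
    posterior α (M *ᵥ Z) = posterior α Z ᵥ* revMatrix α M := by
  funext s
  have h1 : ∑ t, α t * (M *ᵥ Z) t = ∑ t, α t * Z t := by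
    simp only [Matrix.mulVec, dotProduct, Finset.mul_sum]
    rw [Finset.sum_comm]
    refine Finset.sum_congr rfl fun t _ => ?_
    rw [← sum_mul_apply_of_invariant hα_inv t, Finset.sum_mul]
    exact Finset.sum_congr rfl fun i _ => by ring
  simp only [posterior, h1]
  simp only [Matrix.mulVec, Matrix.vecMul, dotProduct, revMatrix, Matrix.of_apply]
  rw [Finset.mul_sum, Finset.sum_div]
  refine Finset.sum_congr rfl fun t _ => ?_
  rw [posterior]
  field_simp [(hα_pos t).ne']

end Entropy

/-! ### Functions of finitely many spins -/

section FiniteDependence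

variable {d : List ℕ → ℕ} {q : ℕ}

/-- The restriction of configurations to a finite set of vertices. -/
abbrev spinsOn (A : Finset (Vertex d)) : Config d q → A → Fin q := A.restrict

theorem measurable_spinsOn (A : Finset (Vertex d)) :
    Measurable (spinsOn A : Config d q → A → Fin q) :=
  Finset.measurable_restrict A

theorem agreeOn_eq_preimage (A : Finset (Vertex d)) (η : Config d q) :
    agreeOn (A : Set (Vertex d)) η = spinsOn A ⁻¹' {spinsOn A η} := by
  ext σ
  simp [agreeOn, funext_iff]

theorem agreeOn_union (A B : Set (Vertex d)) (η : Config d q) :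
    agreeOn (A ∪ B) η = agreeOn A η ∩ agreeOn B η := by
  ext σ
  simp only [agreeOn, Set.mem_union, Set.mem_inter_iff, Set.mem_ofPred_eq, or_imp, forall_and]

theorem agreeOn_congr {A : Set (Vertex d)} {η ξ : Config d q} (h : ∀ v ∈ A, η v = ξ v) :
    agreeOn A η = agreeOn A ξ := by
  ext σ
  exact forall₂_congr fun v hv => by rw [h v hv]

theorem exists_eq_comp_restrict {β : Type*} [Nonempty β] {A : Finset (Vertex d)}
    {f : Config d q → β} (hf : DependsOn f A) : ∃ f' : (A → Fin q) → β, f = f' ∘ spinsOn A :=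
  (Function.factorsThrough_iff f).1 (dependsOn_iff_factorsThrough.1 hf)

theorem measurable_of_dependsOn {β : Type*} [Nonempty β] [MeasurableSpace β]
    {A : Finset (Vertex d)} {f : Config d q → β} (hf : DependsOn f A) : Measurable f := by
  obtain ⟨f', rfl⟩ := exists_eq_comp_restrict hf
  exact Measurable.of_discrete.comp (measurable_spinsOn A)

theorem measurableSet_agreeOn (A : Set (Vertex d)) (η : Config d q) :
    MeasurableSet (agreeOn A η) := by
  have : agreeOn A η = ⋂ v ∈ A, (fun σ : Config d q => σ v) ⁻¹' {η v} := by
    ext σ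
    simp [agreeOn]
  rw [this]
  exact MeasurableSet.biInter A.to_countable fun v _ =>
    measurable_pi_apply v (measurableSet_singleton _)

theorem integrable_of_dependsOn {μ : Measure (Config d q)} [IsFiniteMeasure μ]
    {A : Finset (Vertex d)} {f : Config d q → ℝ} (hf : DependsOn f A) : Integrable f μ := by
  obtain ⟨f', rfl⟩ := exists_eq_comp_restrict hf
  exact Integrable.comp_measurable (μ := μ) (Integrable.of_finite) (measurable_spinsOn A)

theorem spinsOn_preimage_singleton (A : Finset (Vertex d)) (x : A → Fin q) :
    spinsOn A ⁻¹' {x} = (∅ : Set (Config d q)) ∨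
      ∃ ξ : Config d q, spinsOn A ξ = x ∧ spinsOn A ⁻¹' {x} = agreeOn (A : Set (Vertex d)) ξ := by
  rcases Set.eq_empty_or_nonempty (spinsOn A ⁻¹' {x} : Set (Config d q)) with h | ⟨ξ, hξ⟩
  · exact Or.inl h
  · refine Or.inr ⟨ξ, hξ, ?_⟩
    rw [agreeOn_eq_preimage, show spinsOn A ξ = x from hξ]

/-- If `g ξ`, which depends on the spins in the finite set `A` only, is the elementary conditional
probability of `E` given the spins in `A`, then it is a version of the conditional expectation. -/
theorem setIntegral_eq_integral_mul {μ : Measure (Config d q)} [IsFiniteMeasure μ]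
    {A : Finset (Vertex d)} {E : Set (Config d q)} {g φ : Config d q → ℝ}
    (hg : DependsOn g A) (hφ : DependsOn φ A)
    (h : ∀ ξ, μ.real (agreeOn A ξ ∩ E) = g ξ * μ.real (agreeOn A ξ)) :
    ∫ σ in E, φ σ ∂μ = ∫ σ, g σ * φ σ ∂μ := by
  obtain ⟨φ', rfl⟩ := exists_eq_comp_restrict hφ
  obtain ⟨g', rfl⟩ := exists_eq_comp_restrict hg
  have hr := measurable_spinsOn (q := q) A
  have h1 : ∫ σ in E, (φ' ∘ spinsOn A) σ ∂μ = ∫ x, φ' x ∂((μ.restrict E).map (spinsOn A)) :=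
    (integral_map hr.aemeasurable (Measurable.of_discrete.aestronglyMeasurable)).symm
  have h2 : ∫ σ, (g' ∘ spinsOn A) σ * (φ' ∘ spinsOn A) σ ∂μ =
      ∫ x, g' x * φ' x ∂(μ.map (spinsOn A)) :=
    (integral_map hr.aemeasurable
      (Measurable.of_discrete (f := fun x => g' x * φ' x)).aestronglyMeasurable).symm
  rw [h1, h2, integral_fintype Integrable.of_finite, integral_fintype Integrable.of_finite]
  refine Finset.sum_congr rfl fun x _ => ?_
  rw [map_measureReal_apply hr (measurableSet_singleton x),
    map_measureReal_apply hr (measurableSet_singleton x),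
    measureReal_restrict_apply (hr (measurableSet_singleton x))]
  rcases spinsOn_preimage_singleton A x with h0 | ⟨ξ, hξ, h0⟩
  · simp [h0]
  · rw [h0, h ξ, Function.comp_apply, hξ, smul_eq_mul, smul_eq_mul]
    ring

/-- Two integrals agree if they agree on the fibres of the restriction to a finite set of
vertices. -/
theorem integral_eq_of_fibres {μ : Measure (Config d q)} [IsFiniteMeasure μ]
    {A : Finset (Vertex d)} {f g : Config d q → ℝ} (hf : Integrable f μ) (hg : Integrable g μ)
    (h : ∀ ξ, ∫ σ in agreeOn A ξ, f σ ∂μ = ∫ σ in agreeOn A ξ, g σ ∂μ) :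
    ∫ σ, f σ ∂μ = ∫ σ, g σ ∂μ := by
  have hr := measurable_spinsOn (q := q) A
  have key : ∀ f : Config d q → ℝ, Integrable f μ →
      ∫ σ, f σ ∂μ = ∑ x : A → Fin q, ∫ σ in spinsOn A ⁻¹' {x}, f σ ∂μ := by
    intro f hf
    rw [← integral_iUnion_fintype (fun x => hr (measurableSet_singleton x))
      (fun x y hxy => Disjoint.preimage _ (Set.disjoint_singleton.2 hxy))
      (fun x => hf.integrableOn), ← Set.preimage_iUnion, Set.iUnion_of_singleton, Set.preimage_univ,
      Measure.restrict_univ]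
  rw [key f hf, key g hg]
  refine Finset.sum_congr rfl fun x _ => ?_
  rcases spinsOn_preimage_singleton A x with h0 | ⟨ξ, hξ, h0⟩
  · rw [h0]; simp
  · rw [h0, h ξ]

/-- The configuration `η`, modified on `A` by `x`. -/
def patch (A : Finset (Vertex d)) (x : A → Fin q) (η : Config d q) : Config d q :=
  fun v => if h : v ∈ A then x ⟨v, h⟩ else η v

theorem patch_of_mem {A : Finset (Vertex d)} {x : A → Fin q} {η : Config d q} {v : Vertex d}
    (h : v ∈ A) : patch A x η v = x ⟨v, h⟩ := dif_pos h

theorem patch_of_notMem {A : Finset (Vertex d)} {x : A → Fin q} {η : Config d q} {v : Vertex d}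
    (h : v ∉ A) : patch A x η v = η v := dif_neg h

theorem agreeOn_patch (A : Finset (Vertex d)) (x : A → Fin q) (η : Config d q) :
    agreeOn (A : Set (Vertex d)) (patch A x η) = spinsOn A ⁻¹' {x} := by
  rw [agreeOn_eq_preimage]
  congr 2
  funext v
  exact patch_of_mem v.2

/-- The law of total probability for the spins in a finite set of vertices. -/
theorem measureReal_eq_sum {μ : Measure (Config d q)} [IsFiniteMeasure μ] (A : Finset (Vertex d))
    (η : Config d q) {E : Set (Config d q)} (hE : MeasurableSet E) :
    μ.real E = ∑ x : A → Fin q, μ.real (E ∩ agreeOn A (patch A x η)) := by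
  have hr := measurable_spinsOn (q := q) A
  simp_rw [agreeOn_patch]
  rw [← measureReal_iUnion_fintype]
  · rw [← Set.inter_iUnion, ← Set.preimage_iUnion, Set.iUnion_of_singleton, Set.preimage_univ,
      Set.inter_univ]
  · exact fun x y hxy => Disjoint.mono Set.inter_subset_right Set.inter_subset_right
      (Disjoint.preimage _ (Set.disjoint_singleton.2 hxy))
  · exact fun x => hE.inter (hr (measurableSet_singleton x))

theorem setIntegral_eq_sum {μ : Measure (Config d q)} [IsFiniteMeasure μ] {A : Finset (Vertex d)}
    (η : Config d q) (E : Set (Config d q)) {φ : Config d q → ℝ} (hφ : DependsOn φ A) :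
    ∫ σ in E, φ σ ∂μ =
      ∑ x : A → Fin q, φ (patch A x η) * μ.real (E ∩ agreeOn A (patch A x η)) := by
  obtain ⟨φ', rfl⟩ := exists_eq_comp_restrict hφ
  have hr := measurable_spinsOn (q := q) A
  have h1 : ∫ σ in E, (φ' ∘ spinsOn A) σ ∂μ = ∫ x, φ' x ∂((μ.restrict E).map (spinsOn A)) :=
    (integral_map hr.aemeasurable (Measurable.of_discrete.aestronglyMeasurable)).symm
  rw [h1, integral_fintype Integrable.of_finite]
  refine Finset.sum_congr rfl fun x _ => ?_
  rw [map_measureReal_apply hr (measurableSet_singleton x), agreeOn_patch,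
    measureReal_restrict_apply (hr (measurableSet_singleton x)), Set.inter_comm, smul_eq_mul,
    mul_comm]
  congr 2
  funext v
  exact (patch_of_mem v.2).symm

/-! ### Balls and levels -/

/-- The vertices at distance at most `N` from the root. -/
noncomputable def ball (d : List ℕ → ℕ) (N : ℕ) : Finset (Vertex d) := (finite_ball d N).toFinset

@[simp] theorem mem_ball {N : ℕ} {v : Vertex d} : v ∈ ball d N ↔ height v ≤ N := by
  simp [ball]

theorem coe_ball (N : ℕ) : (ball d N : Set (Vertex d)) = {v | height v ≤ N} := by
  ext v
  simp

/-- The vertices at distance `N` from the root. -/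
noncomputable def level (d : List ℕ → ℕ) (N : ℕ) : Finset (Vertex d) :=
  (ball d N).filter fun v => height v = N

@[simp] theorem mem_level {N : ℕ} {v : Vertex d} : v ∈ level d N ↔ height v = N := by
  simp only [level, Finset.mem_filter, mem_ball]
  omega

theorem coe_level (N : ℕ) : (level d N : Set (Vertex d)) = {v | height v = N} := by
  ext v
  simp

@[simp] theorem height_root : height (root d) = 0 := rfl

theorem height_eq_zero {v : Vertex d} : height v = 0 ↔ v = root d := by
  rw [height, List.length_eq_zero_iff, Subtype.ext_iff]
  rfl

theorem height_parent (v : Vertex d) : height (parent v) = height v - 1 := by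
  simp [height, parent]

theorem mem_nonRootBall {N : ℕ} {v : Vertex d} :
    v ∈ nonRootBall d N ↔ v ≠ root d ∧ height v ≤ N := by
  simp [nonRootBall]

theorem exists_subset_ball (A : Finset (Vertex d)) : ∃ N, A ⊆ ball d N :=
  ⟨A.sup height, fun _ hv => mem_ball.2 (Finset.le_sup (f := height) hv)⟩

theorem ball_mono {m n : ℕ} (h : m ≤ n) : ball d m ⊆ ball d n := fun _ hv =>
  mem_ball.2 ((mem_ball.1 hv).trans h)

/-- A finite measure on configurations is determined by its values on the cylinders over balls. -/
theorem measure_ext_of_ball {μ μ' : Measure (Config d q)} [IsFiniteMeasure μ] [IsFiniteMeasure μ']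
    (h : ∀ N η, μ (agreeOn {v | height v ≤ N} η) = μ' (agreeOn {v | height v ≤ N} η)) :
    μ = μ' := by
  have hball : ∀ N, μ.map (spinsOn (ball d N)) = μ'.map (spinsOn (ball d N)) := by
    intro N
    refine Measure.ext_of_singleton fun x => ?_
    rw [Measure.map_apply (measurable_spinsOn _) (measurableSet_singleton x),
      Measure.map_apply (measurable_spinsOn _) (measurableSet_singleton x)]
    rcases spinsOn_preimage_singleton (ball d N) x with h0 | ⟨ξ, -, h0⟩
    · simp [h0]
    · rw [h0, coe_ball, h]
  refine IsProjectiveLimit.unique (P := fun I => μ'.map I.restrict) (fun I => ?_) fun I => rfl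
  obtain ⟨N, hN⟩ := exists_subset_ball I
  have h2 := Finset.measurable_restrict₂ (X := fun _ : Vertex d => Fin q) hN
  change μ.map I.restrict = μ'.map I.restrict
  rw [← Finset.restrict₂_comp_restrict hN, ← Measure.map_map h2 (measurable_spinsOn _), hball,
    Measure.map_map h2 (measurable_spinsOn _)]

end FiniteDependence

/-! ### Existence and uniqueness of the tree-indexed Markov chain -/

section Existence

variable {d : List ℕ → ℕ} {q : ℕ} {M : Matrix (Fin q) (Fin q) ℝ} {α : Fin q → ℝ}

theorem IsTreeChain.unique {P P' : Measure (Config d q)} (h : IsTreeChain M α d P)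
    (h' : IsTreeChain M α d P') : P = P' := by
  have := h.isProb
  have := h'.isProb
  exact measure_ext_of_ball fun N η => by rw [h.marginal, h'.marginal]

/-- The measure on `Fin q` with weights `p`. -/
noncomputable def weightMeasure (p : Fin q → ℝ) : Measure (Fin q) :=
  ∑ i, ENNReal.ofReal (p i) • Measure.dirac i

theorem weightMeasure_singleton (p : Fin q → ℝ) (i : Fin q) :
    weightMeasure p {i} = ENNReal.ofReal (p i) := by
  simp [weightMeasure, Measure.finsetSum_apply, Set.indicator_apply]

theorem isProbabilityMeasure_weightMeasure {p : Fin q → ℝ} (hp : p ∈ stdSimplex ℝ (Fin q)) :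
    IsProbabilityMeasure (weightMeasure p) := by
  refine ⟨?_⟩
  simp [weightMeasure, Measure.finsetSum_apply]
  rw [← ENNReal.ofReal_sum_of_nonneg fun i _ => hp.1 i, hp.2, ENNReal.ofReal_one]

/-- The spin at a word, computed from the spin at the root and from a family of random transitions:
`ω.2 (w, s)` is the spin at `w` when the spin at the parent of `w` is `s`. -/
def spinAt (ω : Fin q × (Vertex d × Fin q → Fin q)) : (v : List ℕ) → IsVertex d v → Fin q
  | [], _ => ω.1
  | k :: v, h => ω.2 (⟨k :: v, h⟩, spinAt ω v h.2)

theorem measurable_spinAt : ∀ (v : List ℕ) (h : IsVertex d v),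
    Measurable fun ω : Fin q × (Vertex d × Fin q → Fin q) => spinAt ω v h
  | [], _ => measurable_fst
  | k :: v, h => by
    have h1 : Measurable fun x : (Fin q × (Vertex d × Fin q → Fin q)) × Fin q =>
        x.1.2 (⟨k :: v, h⟩, x.2) :=
      measurable_from_prod_countable_left fun s =>
        (measurable_pi_apply ((⟨k :: v, h⟩, s) : Vertex d × Fin q)).comp measurable_snd
    exact h1.comp (measurable_id.prodMk (measurable_spinAt v h.2))

/-- The configuration computed from a family of transitions. -/
def spins (ω : Fin q × (Vertex d × Fin q → Fin q)) : Config d q := fun v => spinAt ω v.1 v.2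

theorem spins_root (ω : Fin q × (Vertex d × Fin q → Fin q)) : spins ω (root d) = ω.1 := rfl

theorem spins_eq (ω : Fin q × (Vertex d × Fin q → Fin q)) {w : Vertex d} (hw : w ≠ root d) :
    spins ω w = ω.2 (w, spins ω (parent w)) := by
  obtain ⟨l, hl⟩ := w
  cases l with
  | nil => exact absurd rfl hw
  | cons k v => rfl

theorem spins_preimage_agreeOn (N : ℕ) (η : Config d q) :
    spins ⁻¹' agreeOn {v | height v ≤ N} η = {η (root d)} ×ˢ
      Set.pi ((nonRootBall d N).image fun w => (w, η (parent w)) : Finset (Vertex d × Fin q))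
        fun p => {η p.1} := by
  ext ω
  rw [Finset.coe_image, Set.mem_prod, Set.mem_pi, Set.forall_mem_image]
  simp only [Set.mem_preimage, agreeOn, Set.mem_ofPred_eq, Set.mem_singleton_iff, Finset.mem_coe,
    mem_nonRootBall, and_imp]
  constructor
  · refine fun h => ⟨h (root d) (Nat.zero_le N), fun w hw hN => ?_⟩
    rw [← h (parent w) (by rw [height_parent]; omega), ← spins_eq ω hw, h w hN]
  · rintro ⟨h0, h⟩
    suffices H : ∀ n, ∀ v : Vertex d, height v = n → n ≤ N → spins ω v = η v from
      fun v hv => H _ v rfl hv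
    intro n
    induction n with
    | zero =>
      intro v hv _
      rw [height_eq_zero.1 hv, spins_root, h0]
    | succ n ih =>
      intro v hv hN
      have hne : v ≠ root d := fun h => by rw [h, height_root] at hv; omega
      rw [spins_eq ω hne, ih (parent v) (by rw [height_parent]; omega) (by omega)]
      exact h hne (by omega)

/-- The chain is built from the spin at the root and independent transitions at all vertices. -/
theorem exists_isTreeChain (hM_pos : ∀ i j, 0 < M i j) (hM_row : ∀ i, ∑ j, M i j = 1)
    (hα : α ∈ stdSimplex ℝ (Fin q)) (d : List ℕ → ℕ) :
    ∃ P : Measure (Config d q), IsTreeChain M α d P := by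
  have hα' := isProbabilityMeasure_weightMeasure hα
  have hM' : ∀ p : Vertex d × Fin q, IsProbabilityMeasure (weightMeasure (M p.2)) := fun p =>
    isProbabilityMeasure_weightMeasure ⟨fun j => (hM_pos _ j).le, hM_row _⟩
  have hmeas : Measurable (spins : Fin q × (Vertex d × Fin q → Fin q) → Config d q) :=
    measurable_pi_lambda _ fun v => measurable_spinAt v.1 v.2
  refine ⟨((weightMeasure α).prod
    (Measure.infinitePi fun p : Vertex d × Fin q => weightMeasure (M p.2))).map spins,
    Measure.isProbabilityMeasure_map hmeas.aemeasurable, fun N η => ?_⟩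
  rw [Measure.map_apply hmeas (measurableSet_agreeOn _ _), spins_preimage_agreeOn,
    Measure.prod_prod, Measure.infinitePi_pi _ fun p _ => measurableSet_singleton _,
    Finset.prod_image fun w _ w' _ h => congrArg Prod.fst h, weightMeasure_singleton,
    ENNReal.ofReal_mul (hα.1 _), ENNReal.ofReal_prod_of_nonneg fun w _ => (hM_pos _ _).le]
  simp only [weightMeasure_singleton]

end Existence

/-! ### The Markov property -/

section Markov

variable {d : List ℕ → ℕ} {q : ℕ} {M : Matrix (Fin q) (Fin q) ℝ} {α : Fin q → ℝ}
  {P : Measure (Config d q)}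

/-- The `j`-th child of a vertex. -/
def child (v : Vertex d) (j : Fin (d v.1)) : Vertex d := ⟨(j : ℕ) :: v.1, j.2, v.2⟩

@[simp] theorem parent_child (v : Vertex d) (j : Fin (d v.1)) : parent (child v j) = v := rfl

@[simp] theorem height_child (v : Vertex d) (j : Fin (d v.1)) : height (child v j) = height v + 1 :=
  rfl

theorem child_injective (v : Vertex d) : Function.Injective (child v) := by
  intro i j h
  have : (i : ℕ) :: v.1 = (j : ℕ) :: v.1 := congrArg Subtype.val h
  exact Fin.ext (List.cons.inj this).1

theorem exists_child_eq {w : Vertex d} (hw : w ≠ root d) : ∃ j, child (parent w) j = w := by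
  obtain ⟨l, hl⟩ := w
  cases l with
  | nil => exact absurd rfl hw
  | cons k v => exact ⟨⟨k, hl.1⟩, rfl⟩

theorem prod_level_succ {β : Type*} [CommMonoid β] (n : ℕ) (f : Vertex d → β) :
    ∏ w ∈ level d (n + 1), f w = ∏ v ∈ level d n, ∏ j, f (child v j) := by
  have h : level d (n + 1) = (level d n).biUnion fun v => Finset.univ.image (child v) := by
    ext w
    simp only [mem_level, Finset.mem_biUnion, Finset.mem_image, Finset.mem_univ, true_and]
    constructor
    · intro hw
      have hne : w ≠ root d := fun h => by rw [h, height_root] at hw; omega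
      exact ⟨parent w, by rw [height_parent]; omega, exists_child_eq hne⟩
    · rintro ⟨v, hv, j, rfl⟩
      rw [height_child, hv]
  rw [h, Finset.prod_biUnion]
  · exact Finset.prod_congr rfl fun v _ =>
      Finset.prod_image fun i _ j _ hij => child_injective v hij
  · intro v _ v' _ hne
    refine Finset.disjoint_left.2 fun w hw hw' => hne ?_
    obtain ⟨i, -, rfl⟩ := Finset.mem_image.1 hw
    obtain ⟨j, -, h⟩ := Finset.mem_image.1 hw'
    rw [← parent_child v i, ← h, parent_child]

theorem measureReal_agreeOn_ball (hP : IsTreeChain M α d P) (hM_pos : ∀ i j, 0 < M i j)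
    (hα : ∀ i, 0 < α i) (N : ℕ) (η : Config d q) :
    P.real (agreeOn (ball d N) η) =
      α (η (root d)) * ∏ w ∈ nonRootBall d N, M (η (parent w)) (η w) := by
  rw [coe_ball, measureReal_def, hP.marginal, ENNReal.toReal_ofReal]
  exact mul_nonneg (hα _).le (Finset.prod_nonneg fun w _ => (hM_pos _ _).le)

theorem measureReal_agreeOn_ball_succ (hP : IsTreeChain M α d P) (hM_pos : ∀ i j, 0 < M i j)
    (hα : ∀ i, 0 < α i) (N : ℕ) (η : Config d q) :
    P.real (agreeOn (ball d (N + 1)) η) = P.real (agreeOn (ball d N) η) *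
      ∏ w ∈ level d (N + 1), M (η (parent w)) (η w) := by
  have h : nonRootBall d (N + 1) = nonRootBall d N ∪ level d (N + 1) := by
    ext w
    simp only [mem_nonRootBall, Finset.mem_union, mem_level, ← height_eq_zero, ne_eq]
    omega
  have h' : Disjoint (nonRootBall d N) (level d (N + 1)) := by
    refine Finset.disjoint_left.2 fun w hw hw' => ?_
    have h1 := (mem_nonRootBall.1 hw).2
    rw [mem_level] at hw'
    omega
  rw [measureReal_agreeOn_ball hP hM_pos hα, measureReal_agreeOn_ball hP hM_pos hα, h,
    Finset.prod_union h', mul_assoc]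

theorem dependsOn_of_subset {β : Type*} {f : Config d q → β} {A B : Set (Vertex d)}
    (hf : DependsOn f A) (h : A ⊆ B) : DependsOn f B :=
  fun _ _ hxy => hf fun v hv => hxy v (h hv)

theorem dependsOn_prod {A : Finset (Vertex d)} {B : Set (Vertex d)}
    {f : Vertex d → Config d q → ℝ} (h : ∀ v ∈ A, DependsOn (f v) B) :
    DependsOn (fun σ : Config d q => ∏ v ∈ A, f v σ) B :=
  fun _ _ hxy => Finset.prod_congr rfl fun v hv => h v hv hxy

theorem dependsOn_apply {β : Type*} {A : Set (Vertex d)} {v : Vertex d} (hv : v ∈ A)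
    (f : Fin q → β) : DependsOn (fun σ : Config d q => f (σ v)) A :=
  fun x y hxy => show f (x v) = f (y v) by rw [hxy v hv]

theorem dependsOn_mul {A : Set (Vertex d)} {f g : Config d q → ℝ} (hf : DependsOn f A)
    (hg : DependsOn g A) : DependsOn (fun σ => f σ * g σ) A :=
  fun x y hxy => show f x * g x = f y * g y by rw [hf hxy, hg hxy]

theorem dependsOn_mem_agreeOn (A : Set (Vertex d)) (η : Config d q) :
    DependsOn (fun σ : Config d q => σ ∈ agreeOn A η) A := fun σ σ' h =>
  propext (forall₂_congr fun v hv => by rw [h v hv])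

theorem dependsOn_indicator {A : Set (Vertex d)} {E : Set (Config d q)}
    (hE : DependsOn (fun σ : Config d q => σ ∈ E) A) :
    DependsOn (E.indicator fun _ => (1 : ℝ)) A := by
  intro σ σ' h
  have h1 : σ ∈ E ↔ σ' ∈ E := iff_of_eq (hE h)
  by_cases h2 : σ ∈ E
  · rw [Set.indicator_of_mem h2, Set.indicator_of_mem (h1.1 h2)]
  · rw [Set.indicator_of_notMem h2, Set.indicator_of_notMem (mt h1.2 h2)]

/-- Given the spins in the ball of radius `n`, the spins at the next level are independent, and
each is chosen by the transition matrix from the spin at the parent. -/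
theorem integral_mul_prod_level_succ (hP : IsTreeChain M α d P) (hM_pos : ∀ i j, 0 < M i j)
    (hα : ∀ i, 0 < α i) {n : ℕ} {F : Config d q → ℝ} (hF : DependsOn F (ball d n))
    (h : Vertex d → Fin q → ℝ) :
    ∫ σ, F σ * ∏ w ∈ level d (n + 1), h w (σ w) ∂P =
      ∫ σ, F σ * ∏ w ∈ level d (n + 1), (M *ᵥ h w) (σ (parent w)) ∂P := by
  have := hP.isProb
  have hsub : (ball d n : Set (Vertex d)) ⊆ ball d (n + 1) :=
    Finset.coe_subset.2 (ball_mono n.le_succ)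
  have hmem : ∀ w ∈ level d (n + 1), w ∈ (ball d (n + 1) : Set (Vertex d)) := fun w hw => by
    simpa using (mem_level.1 hw).le
  have hmem' : ∀ w ∈ level d (n + 1), parent w ∈ (ball d n : Set (Vertex d)) := fun w hw => by
    have := mem_level.1 hw
    simp only [Finset.mem_coe, mem_ball, height_parent]
    omega
  refine integral_eq_of_fibres (A := ball d n)
    (integrable_of_dependsOn (A := ball d (n + 1)) (dependsOn_mul (dependsOn_of_subset hF hsub)
      (dependsOn_prod fun w hw => dependsOn_apply (hmem w hw) _)))
    (integrable_of_dependsOn (A := ball d n) (dependsOn_mul hF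
      (dependsOn_prod fun w hw => dependsOn_apply (hmem' w hw) _))) fun ξ => ?_
  have hE := measurableSet_agreeOn (ball d n : Set (Vertex d)) ξ
  have h1 : ∫ σ in agreeOn (ball d n) ξ, F σ * ∏ w ∈ level d (n + 1), h w (σ w) ∂P =
      F ξ * ∫ σ in agreeOn (ball d n) ξ, ∏ w ∈ level d (n + 1), h w (σ w) ∂P := by
    rw [← integral_const_mul]
    exact setIntegral_congr_fun hE fun σ hσ => by simp only [hF hσ]
  have h2 : ∫ σ in agreeOn (ball d n) ξ,
        F σ * ∏ w ∈ level d (n + 1), (M *ᵥ h w) (σ (parent w)) ∂P =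
      F ξ * (P.real (agreeOn (ball d n) ξ) *
        ∏ w ∈ level d (n + 1), (M *ᵥ h w) (ξ (parent w))) := by
    rw [setIntegral_congr_fun (g := fun _ => F ξ * ∏ w ∈ level d (n + 1), (M *ᵥ h w) (ξ (parent w)))
      hE, setIntegral_const, smul_eq_mul]
    · ring
    · intro σ hσ
      have h3 : ∀ w ∈ level d (n + 1), (M *ᵥ h w) (σ (parent w)) = (M *ᵥ h w) (ξ (parent w)) :=
        fun w hw => by rw [hσ _ (hmem' w hw)]
      simp only [hF hσ, Finset.prod_congr rfl h3]
  rw [h1, h2, setIntegral_eq_sum (A := level d (n + 1)) ξ _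
    (dependsOn_prod fun w hw => dependsOn_apply (Finset.mem_coe.2 hw) _)]
  congr 1
  have h4 : ∀ x : level d (n + 1) → Fin q, ∀ v ∈ (ball d n : Set (Vertex d)),
      patch (level d (n + 1)) x ξ v = ξ v := by
    intro x v hv
    refine patch_of_notMem fun hv' => ?_
    have h5 := mem_level.1 hv'
    have h6 := mem_ball.1 (Finset.mem_coe.1 hv)
    omega
  have h5 : ∀ x : level d (n + 1) → Fin q,
      agreeOn (ball d n) ξ ∩ agreeOn (level d (n + 1)) (patch (level d (n + 1)) x ξ) =
        agreeOn (ball d (n + 1)) (patch (level d (n + 1)) x ξ) := by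
    intro x
    rw [← agreeOn_congr (h4 x), ← agreeOn_union, ← Finset.coe_union]
    congr 2
    ext v
    simp only [Finset.mem_union, mem_ball, mem_level]
    omega
  have h6 : ∀ x : level d (n + 1) → Fin q,
      (∏ w ∈ level d (n + 1), h w (patch (level d (n + 1)) x ξ w)) *
        P.real (agreeOn (ball d (n + 1)) (patch (level d (n + 1)) x ξ)) =
      P.real (agreeOn (ball d n) ξ) *
        ∏ w : level d (n + 1), M (ξ (parent w.1)) (x w) * h w (x w) := by
    intro x
    rw [measureReal_agreeOn_ball_succ hP hM_pos hα, agreeOn_congr (h4 x), mul_left_comm,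
      ← Finset.prod_mul_distrib, ← Finset.prod_coe_sort]
    congr 1
    refine Finset.prod_congr rfl fun w _ => ?_
    rw [patch_of_mem w.2, h4 x _ (hmem' w.1 w.2), mul_comm]
  simp_rw [h5, h6]
  rw [← Finset.mul_sum, ← Finset.prod_coe_sort]
  congr 1
  simp only [Matrix.mulVec, dotProduct]
  rw [Finset.prod_univ_sum, Fintype.piFinset_univ]

/-! ### Likelihoods -/

/-- The expectation of `∏ h u (σ u)` over the descendants `u` of `v` in the `k`-th generation,
conditioned on the spin at `v`, by the recursion over the children of `v`. -/
noncomputable def message (M : Matrix (Fin q) (Fin q) ℝ) (h : Vertex d → Fin q → ℝ) :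
    ℕ → Vertex d → Fin q → ℝ
  | 0, v => h v
  | k + 1, v => fun s => ∏ j, (M *ᵥ message M h k (child v j)) s

theorem message_message_one (h : Vertex d → Fin q → ℝ) (k : ℕ) :
    message M (message M h 1) k = message M h (k + 1) := by
  induction k with
  | zero => rfl
  | succ k ih =>
    funext v s
    exact Finset.prod_congr rfl fun j _ =>
      congrArg (fun Z => (M *ᵥ Z) s) (congrFun ih (child v j))

theorem integral_mul_prod_level (hP : IsTreeChain M α d P) (hM_pos : ∀ i j, 0 < M i j)
    (hα : ∀ i, 0 < α i) {n : ℕ} {F : Config d q → ℝ} (hF : DependsOn F (ball d n)) (k : ℕ)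
    (h : Vertex d → Fin q → ℝ) :
    ∫ σ, F σ * ∏ w ∈ level d (n + k), h w (σ w) ∂P =
      ∫ σ, F σ * ∏ v ∈ level d n, message M h k v (σ v) ∂P := by
  induction k generalizing h with
  | zero => rfl
  | succ k ih =>
    rw [← add_assoc, integral_mul_prod_level_succ hP hM_pos hα (dependsOn_of_subset hF
      (Finset.coe_subset.2 (ball_mono (Nat.le_add_right n k)))), ← message_message_one, ← ih]
    simp only [prod_level_succ, parent_child]
    rfl

/-- The descendants of a vertex in the `k`-th generation. -/
noncomputable def descendants : ℕ → Vertex d → Finset (Vertex d)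
  | 0, v => {v}
  | k + 1, v => Finset.univ.biUnion fun j => descendants k (child v j)

theorem exists_append_of_mem_descendants {k : ℕ} {v u : Vertex d} (h : u ∈ descendants k v) :
    ∃ l : List ℕ, l.length = k ∧ u.1 = l ++ v.1 := by
  induction k generalizing v with
  | zero =>
    rw [descendants, Finset.mem_singleton] at h
    exact ⟨[], rfl, by rw [h]; rfl⟩
  | succ k ih =>
    rw [descendants, Finset.mem_biUnion] at h
    obtain ⟨j, -, hj⟩ := h
    obtain ⟨l, hl, hu⟩ := ih hj
    exact ⟨l ++ [(j : ℕ)], by simp [hl], by rw [hu]; simp [child]⟩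

theorem height_of_mem_descendants {k : ℕ} {v u : Vertex d} (h : u ∈ descendants k v) :
    height u = height v + k := by
  obtain ⟨l, hl, hu⟩ := exists_append_of_mem_descendants h
  rw [height, hu, List.length_append, hl, add_comm, height]

theorem descendants_subset_level (k : ℕ) (v : Vertex d) :
    descendants k v ⊆ level d (height v + k) := fun _ hu =>
  mem_level.2 (height_of_mem_descendants hu)

theorem disjoint_descendants (k : ℕ) {v v' : Vertex d} (hh : height v = height v') (h : v ≠ v') :
    Disjoint (descendants k v) (descendants k v') := by
  refine Finset.disjoint_left.2 fun u hu hu' => h ?_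
  obtain ⟨l, -, hl⟩ := exists_append_of_mem_descendants hu
  obtain ⟨l', -, hl'⟩ := exists_append_of_mem_descendants hu'
  exact Subtype.ext (List.append_inj_right' (hl.symm.trans hl') hh)

theorem card_descendants_succ (k : ℕ) (v : Vertex d) :
    (descendants (k + 1) v).card = ∑ j, (descendants k (child v j)).card := by
  rw [descendants, Finset.card_biUnion]
  exact fun i _ j _ hij => disjoint_descendants k rfl fun h => hij (child_injective v h)

theorem message_congr {h h' : Vertex d → Fin q → ℝ} {k : ℕ} {v : Vertex d}
    (hh : ∀ u ∈ descendants k v, h u = h' u) : message M h k v = message M h' k v := by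
  induction k generalizing v with
  | zero => exact hh v (Finset.mem_singleton_self v)
  | succ k ih =>
    funext s
    simp only [message]
    refine Finset.prod_congr rfl fun j _ => ?_
    rw [ih fun u hu => hh u (Finset.mem_biUnion.2 ⟨j, Finset.mem_univ j, hu⟩)]

theorem message_one (hM_row : ∀ i, ∑ j, M i j = 1) (k : ℕ) (v : Vertex d) :
    message M (fun _ _ => 1) k v = fun _ => 1 := by
  induction k generalizing v with
  | zero => rfl
  | succ k ih =>
    funext s
    simp [message, ih, Matrix.mulVec, dotProduct, hM_row]

/-- The probability of the spins `ξ` at the descendants of `v` in the `k`-th generation,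
conditioned on the spin at `v`. -/
noncomputable def likelihood (M : Matrix (Fin q) (Fin q) ℝ) (k : ℕ) (v : Vertex d)
    (ξ : Config d q) : Fin q → ℝ :=
  message M (fun u t => if t = ξ u then 1 else 0) k v

theorem likelihood_succ (k : ℕ) (v : Vertex d) (ξ : Config d q) (s : Fin q) :
    likelihood M (k + 1) v ξ s = ∏ j, (M *ᵥ likelihood M k (child v j) ξ) s := rfl

theorem dependsOn_likelihood (k : ℕ) (v : Vertex d) :
    DependsOn (likelihood (q := q) M k v) (descendants k v) := fun ξ ξ' h =>
  message_congr fun u hu => by rw [h u hu]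

theorem mulVec_likelihood_zero (v : Vertex d) (ξ : Config d q) (s : Fin q) :
    (M *ᵥ likelihood M 0 v ξ) s = M s (ξ v) := by
  simp [likelihood, message, Matrix.mulVec, dotProduct]

theorem mulVec_pos (hM_pos : ∀ i j, 0 < M i j) {Z : Fin q → ℝ} (hZ : ∀ t, 0 < Z t) (s : Fin q) :
    0 < (M *ᵥ Z) s :=
  Finset.sum_pos (fun t _ => mul_pos (hM_pos s t) (hZ t)) ⟨s, Finset.mem_univ s⟩

/-- The likelihood may vanish only for `k = 0`, where it is an indicator. -/
theorem mulVec_likelihood_pos (hM_pos : ∀ i j, 0 < M i j) (k : ℕ) (v : Vertex d) (ξ : Config d q)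
    (s : Fin q) : 0 < (M *ᵥ likelihood M k v ξ) s := by
  induction k generalizing v s with
  | zero =>
    rw [mulVec_likelihood_zero]
    exact hM_pos _ _
  | succ k ih =>
    refine mulVec_pos hM_pos (fun t => ?_) s
    rw [likelihood_succ]
    exact Finset.prod_pos fun j _ => ih _ t

theorem likelihood_succ_pos (hM_pos : ∀ i j, 0 < M i j) (k : ℕ) (v : Vertex d) (ξ : Config d q)
    (s : Fin q) : 0 < likelihood M (k + 1) v ξ s := by
  rw [likelihood_succ]
  exact Finset.prod_pos fun _ _ => mulVec_likelihood_pos hM_pos k _ ξ s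

theorem prod_ite_eq_indicator (A : Finset (Vertex d)) (ξ σ : Config d q) :
    ∏ u ∈ A, (if σ u = ξ u then (1 : ℝ) else 0) =
      (agreeOn (A : Set (Vertex d)) ξ).indicator (fun _ => 1) σ := by
  rw [Finset.prod_boole]
  by_cases hσ : σ ∈ agreeOn (A : Set (Vertex d)) ξ
  · rw [Set.indicator_of_mem hσ]; exact if_pos hσ
  · rw [Set.indicator_of_notMem hσ]; exact if_neg hσ

theorem indicator_eq_mul (E : Set (Config d q)) (F : Config d q → ℝ) (σ : Config d q) :
    E.indicator F σ = F σ * E.indicator (fun _ => 1) σ := by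
  by_cases hσ : σ ∈ E <;> simp [hσ]

theorem setIntegral_agreeOn_level (hP : IsTreeChain M α d P) (hM_pos : ∀ i j, 0 < M i j)
    (hα : ∀ i, 0 < α i) {n : ℕ} {F : Config d q → ℝ} (hF : DependsOn F (ball d n)) (k : ℕ)
    (ξ : Config d q) :
    ∫ σ in agreeOn (level d (n + k)) ξ, F σ ∂P =
      ∫ σ, F σ * ∏ v ∈ level d n, likelihood M k v ξ (σ v) ∂P := by
  have h := integral_mul_prod_level hP hM_pos hα hF k fun u t => if t = ξ u then 1 else 0
  simp only [prod_ite_eq_indicator] at h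
  rw [← integral_indicator (measurableSet_agreeOn _ _)]
  simp only [indicator_eq_mul _ F]
  exact h

theorem setIntegral_agreeOn_descendants (hP : IsTreeChain M α d P) (hM_pos : ∀ i j, 0 < M i j)
    (hM_row : ∀ i, ∑ j, M i j = 1) (hα : ∀ i, 0 < α i) (v : Vertex d) {F : Config d q → ℝ}
    (hF : DependsOn F (ball d (height v))) (k : ℕ) (ξ : Config d q) :
    ∫ σ in agreeOn (descendants k v) ξ, F σ ∂P = ∫ σ, F σ * likelihood M k v ξ (σ v) ∂P := by
  set h : Vertex d → Fin q → ℝ := fun u =>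
    if u ∈ descendants k v then fun t => if t = ξ u then 1 else 0 else fun _ => 1 with hh
  have h1 := integral_mul_prod_level hP hM_pos hα hF k h
  have h2 : ∀ σ : Config d q, ∏ w ∈ level d (height v + k), h w (σ w) =
      (agreeOn (descendants k v : Set (Vertex d)) ξ).indicator (fun _ => 1) σ := by
    intro σ
    rw [← prod_ite_eq_indicator, ← Finset.prod_subset (descendants_subset_level k v)]
    · exact Finset.prod_congr rfl fun u hu => by simp only [hh, if_pos hu]
    · exact fun u _ hu => by simp only [hh, if_neg hu]
  have h3 : ∀ σ : Config d q, ∏ u ∈ level d (height v), message M h k u (σ u) =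
      likelihood M k v ξ (σ v) := by
    intro σ
    rw [Finset.prod_eq_single_of_mem v (mem_level.2 rfl)]
    · exact congrFun (message_congr fun u hu => if_pos hu) _
    · intro u hu hne
      rw [message_congr (h' := fun _ _ => 1), message_one hM_row]
      intro w hw
      simp only [hh]
      rw [if_neg]
      exact Finset.disjoint_left.1 (disjoint_descendants k (mem_level.1 hu) hne) hw
  simp only [h2, h3] at h1
  rw [← h1, ← integral_indicator (measurableSet_agreeOn _ _)]
  simp only [indicator_eq_mul _ F]

theorem integral_mul_apply (hP : IsTreeChain M α d P) (hM_pos : ∀ i j, 0 < M i j)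
    (hM_row : ∀ i, ∑ j, M i j = 1) (hα : ∀ i, 0 < α i) {w : Vertex d} (hw : w ≠ root d)
    {F : Config d q → ℝ} (hF : DependsOn F (ball d (height (parent w)))) (f : Fin q → ℝ) :
    ∫ σ, F σ * f (σ w) ∂P = ∫ σ, F σ * (M *ᵥ f) (σ (parent w)) ∂P := by
  have hh : height w = height (parent w) + 1 := by
    obtain ⟨j, hj⟩ := exists_child_eq hw
    rw [← hj, height_child, parent_child]
  set h : Vertex d → Fin q → ℝ := fun u => if u = w then f else fun _ => 1 with hh'
  have h1 := integral_mul_prod_level_succ hP hM_pos hα hF h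
  have h2 : M *ᵥ (fun _ => (1 : ℝ)) = fun _ => 1 := by
    funext s
    simp [Matrix.mulVec, dotProduct, hM_row]
  have h3 : h w = f := if_pos rfl
  have h4 : ∀ u ∈ level d (height (parent w) + 1), u ≠ w → h u = fun _ => 1 :=
    fun u _ hu => if_neg hu
  have hmem : w ∈ level d (height (parent w) + 1) := mem_level.2 hh
  have h5 : ∀ σ : Config d q, ∏ u ∈ level d (height (parent w) + 1), h u (σ u) = f (σ w) :=
    fun σ => by
      rw [Finset.prod_eq_single_of_mem w hmem fun u hu hne => by rw [h4 u hu hne], h3]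
  have h6 : ∀ σ : Config d q, ∏ u ∈ level d (height (parent w) + 1),
      (M *ᵥ h u) (σ (parent u)) = (M *ᵥ f) (σ (parent w)) :=
    fun σ => by
      rw [Finset.prod_eq_single_of_mem w hmem fun u hu hne => by rw [h4 u hu hne, h2], h3]
  simpa only [h5, h6] using h1

theorem integral_apply (hP : IsTreeChain M α d P) (hM_pos : ∀ i j, 0 < M i j)
    (hM_row : ∀ i, ∑ j, M i j = 1) (hα : ∀ i, 0 < α i) (hα_inv : α ᵥ* M = α) (v : Vertex d)
    (f : Fin q → ℝ) : ∫ σ, f (σ v) ∂P = ∑ s, α s * f s := by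
  have := hP.isProb
  induction hn : height v generalizing v f with
  | zero =>
    obtain ⟨η⟩ : Nonempty (Config d q) := P.nonempty_of_neZero
    have hv := height_eq_zero.1 hn
    have h0 : ball d 0 = {root d} := by
      ext v
      simp [height_eq_zero]
    rw [← setIntegral_univ, setIntegral_eq_sum (A := ball d 0) η _
      (dependsOn_apply (by simp [hn]) f)]
    have h1 : nonRootBall d 0 = ∅ := by
      rw [Finset.eq_empty_iff_forall_notMem]
      intro w hw
      rw [mem_nonRootBall, ne_eq, ← height_eq_zero] at hw
      omega
    simp only [Set.univ_inter, measureReal_agreeOn_ball hP hM_pos hα, h1, Finset.prod_empty,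
      mul_one, hv]
    have hmem : root d ∈ ball d 0 := by simp
    have huniq : ∀ u : ball d 0, u = ⟨root d, hmem⟩ := by
      rintro ⟨u, hu⟩
      rw [h0, Finset.mem_singleton] at hu
      exact Subtype.ext hu
    refine Fintype.sum_bijective (fun x : ball d 0 → Fin q => x ⟨root d, hmem⟩) ⟨?_, ?_⟩ _ _ ?_
    · intro x y hxy
      funext u
      rw [huniq u]
      exact hxy
    · exact fun s => ⟨fun _ => s, rfl⟩
    · intro x
      rw [patch_of_mem hmem, mul_comm]
  | succ n ih =>
    have hne : v ≠ root d := fun h => by rw [h, height_root] at hn; omega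
    have h1 := integral_mul_apply hP hM_pos hM_row hα hne (F := fun _ => 1) (fun _ _ _ => rfl) f
    simp only [one_mul] at h1
    rw [h1, ih (parent v) (M *ᵥ f) (by rw [height_parent]; omega)]
    simp only [Matrix.mulVec, dotProduct, Finset.mul_sum]
    rw [Finset.sum_comm]
    refine Finset.sum_congr rfl fun t _ => ?_
    rw [← sum_mul_apply_of_invariant hα_inv t, Finset.sum_mul]
    exact Finset.sum_congr rfl fun i _ => by ring

end Markov

/-! ### Decay of the expected symmetrized entropy -/

section Decay

variable {d : List ℕ → ℕ} {q : ℕ} {M : Matrix (Fin q) (Fin q) ℝ} {α : Fin q → ℝ}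
  {P : Measure (Config d q)}

theorem measureReal_agreeOn_pos (hP : IsTreeChain M α d P) (hM_pos : ∀ i j, 0 < M i j)
    (hα : ∀ i, 0 < α i) (A : Finset (Vertex d)) (ξ : Config d q) :
    0 < P.real (agreeOn (A : Set (Vertex d)) ξ) := by
  have := hP.isProb
  obtain ⟨N, hN⟩ := exists_subset_ball A
  have h1 : 0 < P.real (agreeOn (ball d N) ξ) := by
    rw [measureReal_agreeOn_ball hP hM_pos hα]
    exact mul_pos (hα _) (Finset.prod_pos fun w _ => hM_pos _ _)
  exact h1.trans_le (measureReal_mono fun σ hσ v hv => hσ v (hN hv))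

/-- The posterior law of the spin at `v`, given the spins in the finite set `D`, is a version of
its conditional law, whenever `Z ξ` is the likelihood of the spins `ξ` in `D`. -/
theorem integral_posterior_mul (hP : IsTreeChain M α d P) (hM_pos : ∀ i j, 0 < M i j)
    (hα : ∀ i, 0 < α i) {D : Finset (Vertex d)} {Z : Config d q → Fin q → ℝ} (hZ : DependsOn Z D)
    {v : Vertex d}
    (h : ∀ ξ (f : Fin q → ℝ), ∫ σ in agreeOn D ξ, f (σ v) ∂P = ∑ s, α s * (f s * Z ξ s))
    {φ : Config d q → ℝ} (hφ : DependsOn φ D) (s : Fin q) :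
    ∫ σ, posterior α (Z σ) s * φ σ ∂P = ∫ σ in {σ | σ v = s}, φ σ ∂P := by
  have := hP.isProb
  have hE : MeasurableSet {σ : Config d q | σ v = s} :=
    measurable_pi_apply (X := fun _ => Fin q) v (measurableSet_singleton s)
  refine (setIntegral_eq_integral_mul (fun ξ ξ' hξ => ?_) hφ fun ξ => ?_).symm
  · simp only [hZ hξ]
  · have h1 : P.real (agreeOn D ξ) = ∑ t, α t * Z ξ t := by
      have := h ξ fun _ => 1
      simpa using this
    have h2 : P.real (agreeOn D ξ ∩ {σ | σ v = s}) = α s * Z ξ s := by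
      have h3 := h ξ fun t => if t = s then 1 else 0
      simp only [ite_mul, one_mul, zero_mul, mul_ite, mul_zero, Finset.sum_ite_eq',
        Finset.mem_univ, if_true] at h3
      rw [← h3, Set.inter_comm, ← measureReal_restrict_apply hE, ← integral_indicator_one hE]
      refine integral_congr_ae (ae_of_all _ fun σ => ?_)
      simp [Set.indicator_apply]
    have h4 := measureReal_agreeOn_pos hP hM_pos hα D ξ
    rw [h2, posterior, h1, div_mul_cancel₀]
    rw [← h1]
    exact h4.ne'

theorem dependsOn_mulVec_likelihood (k : ℕ) (v : Vertex d) :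
    DependsOn (fun ξ : Config d q => M *ᵥ likelihood M k v ξ) (descendants k v) :=
  fun ξ ξ' h => by simp only [dependsOn_likelihood k v h]

theorem descendants_child_subset (k : ℕ) (v : Vertex d) (j : Fin (d v.1)) :
    (descendants k (child v j) : Set (Vertex d)) ⊆ descendants (k + 1) v :=
  Finset.coe_subset.2 (Finset.subset_biUnion_of_mem (fun j => descendants k (child v j))
    (Finset.mem_univ j))

theorem integral_posterior_likelihood (hP : IsTreeChain M α d P) (hM_pos : ∀ i j, 0 < M i j)
    (hM_row : ∀ i, ∑ j, M i j = 1) (hα : ∀ i, 0 < α i) (hα_inv : α ᵥ* M = α) (k : ℕ)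
    (v : Vertex d) {φ : Config d q → ℝ} (hφ : DependsOn φ (descendants k v)) (s : Fin q) :
    ∫ σ, posterior α (likelihood M k v σ) s * φ σ ∂P = ∫ σ in {σ | σ v = s}, φ σ ∂P := by
  refine integral_posterior_mul hP hM_pos hα (dependsOn_likelihood k v) (fun ξ f => ?_) hφ s
  rw [setIntegral_agreeOn_descendants hP hM_pos hM_row hα v (F := fun σ => f (σ v))
    (dependsOn_apply (by simp) f),
    integral_apply hP hM_pos hM_row hα hα_inv v fun t => f t * likelihood M k v ξ t]

theorem integral_posterior_mulVec_likelihood (hP : IsTreeChain M α d P)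
    (hM_pos : ∀ i j, 0 < M i j) (hM_row : ∀ i, ∑ j, M i j = 1) (hα : ∀ i, 0 < α i)
    (hα_inv : α ᵥ* M = α) (k : ℕ) (v : Vertex d) (j : Fin (d v.1)) {φ : Config d q → ℝ}
    (hφ : DependsOn φ (descendants k (child v j))) (s : Fin q) :
    ∫ σ, posterior α (M *ᵥ likelihood M k (child v j) σ) s * φ σ ∂P =
      ∫ σ in {σ | σ v = s}, φ σ ∂P := by
  refine integral_posterior_mul hP hM_pos hα (dependsOn_mulVec_likelihood k (child v j))
    (fun ξ f => ?_) hφ s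
  have hne : child v j ≠ root d := fun h => by
    have := congrArg height h
    simp at this
  rw [setIntegral_agreeOn_descendants hP hM_pos hM_row hα (child v j) (F := fun σ => f (σ v))
    (dependsOn_apply (by simp) f), integral_mul_apply hP hM_pos hM_row hα hne
      (dependsOn_apply (by simp) f), parent_child,
    integral_apply hP hM_pos hM_row hα hα_inv v
      fun t => f t * (M *ᵥ likelihood M k (child v j) ξ) t]

/-- The expected symmetrized entropy of the posterior law at a vertex is additive over the
children: after expansion of the logarithm of the likelihood, each term involves the
observations below one child only, and the posterior law may be conditioned on these. -/
theorem integral_symEntropyReal_posterior_succ (hP : IsTreeChain M α d P)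
    (hM_pos : ∀ i j, 0 < M i j) (hM_row : ∀ i, ∑ j, M i j = 1) (hα : α ∈ stdSimplex ℝ (Fin q))
    (hα_inv : α ᵥ* M = α) (k : ℕ) (v : Vertex d) :
    ∫ σ, symEntropyReal α (posterior α (likelihood M (k + 1) v σ)) ∂P =
      ∑ j, ∫ σ, symEntropyReal α (posterior α (M *ᵥ likelihood M k (child v j) σ)) ∂P := by
  have := hP.isProb
  have hα_pos := invariant_pos hM_pos hα hα_inv
  have h1 : ∀ σ : Config d q, symEntropyReal α (posterior α (likelihood M (k + 1) v σ)) =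
      ∑ j, ∑ s, (posterior α (likelihood M (k + 1) v σ) s *
        Real.log ((M *ᵥ likelihood M k (child v j) σ) s) -
          α s * Real.log ((M *ᵥ likelihood M k (child v j) σ) s)) := by
    intro σ
    rw [symEntropyReal_posterior hα hα_pos (likelihood_succ_pos hM_pos k v σ), Finset.sum_comm]
    refine Finset.sum_congr rfl fun s _ => ?_
    rw [likelihood_succ, Real.log_prod fun j _ => (mulVec_likelihood_pos hM_pos k _ σ s).ne',
      Finset.mul_sum]
    simp only [sub_mul]
  have h2 : ∀ (σ : Config d q) j,
      symEntropyReal α (posterior α (M *ᵥ likelihood M k (child v j) σ)) =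
      ∑ s, (posterior α (M *ᵥ likelihood M k (child v j) σ) s *
        Real.log ((M *ᵥ likelihood M k (child v j) σ) s) -
          α s * Real.log ((M *ᵥ likelihood M k (child v j) σ) s)) := by
    intro σ j
    rw [symEntropyReal_posterior hα hα_pos (mulVec_likelihood_pos hM_pos k _ σ)]
    simp only [sub_mul]
  have hlog : ∀ j s, DependsOn (fun σ : Config d q =>
      Real.log ((M *ᵥ likelihood M k (child v j) σ) s)) (descendants k (child v j)) :=
    fun j s ξ ξ' h => by simp only [dependsOn_likelihood k (child v j) h]
  have hpost : ∀ s, DependsOn (fun σ : Config d q => posterior α (likelihood M (k + 1) v σ) s)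
      (descendants (k + 1) v) := fun s ξ ξ' h => by simp only [dependsOn_likelihood (k + 1) v h]
  have hpost' : ∀ j s, DependsOn (fun σ : Config d q =>
      posterior α (M *ᵥ likelihood M k (child v j) σ) s) (descendants k (child v j)) :=
    fun j s ξ ξ' h => by simp only [dependsOn_likelihood k (child v j) h]
  have hi1 : ∀ j s, Integrable (fun σ : Config d q => posterior α (likelihood M (k + 1) v σ) s *
      Real.log ((M *ᵥ likelihood M k (child v j) σ) s)) P := fun j s =>
    integrable_of_dependsOn (dependsOn_mul (hpost s)
      (dependsOn_of_subset (hlog j s) (descendants_child_subset k v j)))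
  have hi2 : ∀ j s, Integrable (fun σ : Config d q =>
      posterior α (M *ᵥ likelihood M k (child v j) σ) s *
      Real.log ((M *ᵥ likelihood M k (child v j) σ) s)) P := fun j s =>
    integrable_of_dependsOn (dependsOn_mul (hpost' j s) (hlog j s))
  have hi3 : ∀ j s, Integrable (fun σ : Config d q =>
      α s * Real.log ((M *ᵥ likelihood M k (child v j) σ) s)) P := fun j s =>
    (integrable_of_dependsOn (hlog j s)).const_mul _
  have hi4 : ∀ j s, Integrable (fun σ : Config d q => posterior α (likelihood M (k + 1) v σ) s *
      Real.log ((M *ᵥ likelihood M k (child v j) σ) s) -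
        α s * Real.log ((M *ᵥ likelihood M k (child v j) σ) s)) P := fun j s =>
    (hi1 j s).sub (hi3 j s)
  have hi5 : ∀ j s, Integrable (fun σ : Config d q =>
      posterior α (M *ᵥ likelihood M k (child v j) σ) s *
      Real.log ((M *ᵥ likelihood M k (child v j) σ) s) -
        α s * Real.log ((M *ᵥ likelihood M k (child v j) σ) s)) P := fun j s =>
    (hi2 j s).sub (hi3 j s)
  simp only [h1, h2]
  rw [integral_finsetSum _ fun j _ => integrable_finsetSum _ fun s _ => hi4 j s]
  refine Finset.sum_congr rfl fun j _ => ?_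
  rw [integral_finsetSum _ fun s _ => hi4 j s, integral_finsetSum _ fun s _ => hi5 j s]
  refine Finset.sum_congr rfl fun s _ => ?_
  rw [integral_sub (hi1 j s) (hi3 j s), integral_sub (hi2 j s) (hi3 j s),
    integral_posterior_likelihood hP hM_pos hM_row hα_pos hα_inv (k + 1) v
      (dependsOn_of_subset (hlog j s) (descendants_child_subset k v j)),
    integral_posterior_mulVec_likelihood hP hM_pos hM_row hα_pos hα_inv k v j (hlog j s)]

theorem integrable_symEntropyReal_posterior (hP : IsTreeChain M α d P) (k : ℕ) (v : Vertex d) :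
    Integrable (fun σ => symEntropyReal α (posterior α (likelihood M k v σ))) P := by
  have := hP.isProb
  refine integrable_of_dependsOn (A := descendants k v) fun ξ ξ' h => ?_
  simp only [dependsOn_likelihood k v h]

theorem integrable_symEntropyReal_posterior_mulVec (hP : IsTreeChain M α d P) (k : ℕ)
    (v : Vertex d) :
    Integrable (fun σ => symEntropyReal α (posterior α (M *ᵥ likelihood M k v σ))) P := by
  have := hP.isProb
  refine integrable_of_dependsOn (A := descendants k v) fun ξ ξ' h => ?_
  simp only [dependsOn_likelihood k v h]

/-- The entropy cannot be contracted in the last generation, where the posterior law is a point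
mass with infinite symmetrized entropy. The constant bounds the entropy one step above. -/
theorem integral_symEntropyReal_posterior_le (hP : IsTreeChain M α d P)
    (hM_pos : ∀ i j, 0 < M i j) (hM_row : ∀ i, ∑ j, M i j = 1) (hα : α ∈ stdSimplex ℝ (Fin q))
    (hα_inv : α ᵥ* M = α) (hc : entropyConst α M ≠ ∞) (k : ℕ) (v : Vertex d) :
    ∫ σ, symEntropyReal α (posterior α (likelihood M (k + 1) v σ)) ∂P ≤
      (∑ t, symEntropyReal α (posterior α fun s => M s t)) *
        ((entropyConst α M).toReal ^ k * (descendants (k + 1) v).card) := by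
  have := hP.isProb
  have hα_pos := invariant_pos hM_pos hα hα_inv
  rw [integral_symEntropyReal_posterior_succ hP hM_pos hM_row hα hα_inv, card_descendants_succ,
    Nat.cast_sum, Finset.mul_sum, Finset.mul_sum]
  induction k generalizing v with
  | zero =>
    refine Finset.sum_le_sum fun j _ => ?_
    have h1 : ∀ σ : Config d q, symEntropyReal α (posterior α (M *ᵥ likelihood M 0 (child v j) σ)) ≤
        ∑ t, symEntropyReal α (posterior α fun s => M s t) := by
      intro σ
      have h2 : M *ᵥ likelihood M 0 (child v j) σ = fun s => M s (σ (child v j)) :=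
        funext fun s => mulVec_likelihood_zero _ _ _
      rw [h2]
      exact Finset.single_le_sum (f := fun t => symEntropyReal α (posterior α fun s => M s t))
        (fun t _ => symEntropyReal_nonneg hα hα_pos (posterior_mem hα hα_pos fun s => hM_pos s t)
          (posterior_pos hα hα_pos fun s => hM_pos s t)) (Finset.mem_univ _)
    refine (integral_mono (integrable_symEntropyReal_posterior_mulVec hP 0 _)
      (integrable_const _) h1).trans ?_
    simp [descendants]
  | succ k ih =>
    refine Finset.sum_le_sum fun j _ => ?_
    have h1 : ∀ σ : Config d q,
        symEntropyReal α (posterior α (M *ᵥ likelihood M (k + 1) (child v j) σ)) ≤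
        (entropyConst α M).toReal *
          symEntropyReal α (posterior α (likelihood M (k + 1) (child v j) σ)) := by
      intro σ
      have hZ := likelihood_succ_pos hM_pos k (child v j) σ
      rw [posterior_mulVec hα_pos hα_inv]
      exact symEntropyReal_vecMul_le hM_pos hM_row hα hα_inv hc (posterior_mem hα hα_pos hZ)
        (posterior_pos hα hα_pos hZ)
    refine (integral_mono (integrable_symEntropyReal_posterior_mulVec hP _ _)
      ((integrable_symEntropyReal_posterior hP _ _).const_mul _) h1).trans ?_
    rw [integral_const_mul, integral_symEntropyReal_posterior_succ hP hM_pos hM_row hα hα_inv]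
    refine (mul_le_mul_of_nonneg_left (ih (child v j)) ENNReal.toReal_nonneg).trans ?_
    rw [card_descendants_succ, Nat.cast_sum, ← Finset.mul_sum, ← Finset.mul_sum, pow_succ]
    exact le_of_eq (by ring)

/-! ### Loss of the information about the root -/

theorem ae_tendsto_zero_of_summable_integral {Ω : Type*} [MeasurableSpace Ω] {μ : Measure Ω}
    {f : ℕ → Ω → ℝ} (hf : ∀ k, Integrable (f k) μ) (h0 : ∀ k ω, 0 ≤ f k ω)
    (hs : Summable fun k => ∫ ω, f k ω ∂μ) :
    ∀ᵐ ω ∂μ, Tendsto (fun k => f k ω) atTop (𝓝 0) := by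
  have h1 : ∫⁻ ω, ∑' k, ENNReal.ofReal (f k ω) ∂μ ≠ ∞ := by
    rw [lintegral_tsum fun k => (hf k).aestronglyMeasurable.aemeasurable.ennreal_ofReal]
    simp only [← ofReal_integral_eq_lintegral_ofReal (hf _) (ae_of_all _ (h0 _))]
    exact hs.tsum_ofReal_ne_top
  have h2 : AEMeasurable (fun ω => ∑' k, ENNReal.ofReal (f k ω)) μ :=
    AEMeasurable.tsum fun k => (hf k).aestronglyMeasurable.aemeasurable.ennreal_ofReal
  filter_upwards [ae_lt_top' h2 h1] with ω hω
  have h3 := ENNReal.tendsto_atTop_zero_of_tsum_ne_top hω.ne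
  have h4 := (ENNReal.tendsto_toReal ENNReal.zero_ne_top).comp h3
  simpa [Function.comp_def, ENNReal.toReal_ofReal (h0 _ ω)] using h4

/-- If the generations grow more slowly than the powers of `c(M)` decay, the posterior law at every
vertex, given its descendants in a late generation, is close to the invariant law. -/
theorem ae_tendsto_posterior (hP : IsTreeChain M α d P)
    (hM_pos : ∀ i j, 0 < M i j) (hM_row : ∀ i, ∑ j, M i j = 1) (hα : α ∈ stdSimplex ℝ (Fin q))
    (hα_inv : α ᵥ* M = α) (hc : entropyConst α M ≠ ∞)
    (hd : ∀ n, Summable fun k => (entropyConst α M).toReal ^ k * (level d (n + (k + 1))).card) :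
    ∀ᵐ σ ∂P, ∀ v s, Tendsto (fun k => posterior α (likelihood M k v σ) s) atTop (𝓝 (α s)) := by
  have := hP.isProb
  have hα_pos := invariant_pos hM_pos hα hα_inv
  rw [ae_all_iff]
  intro v
  rw [ae_all_iff]
  intro s
  have hdep : ∀ k, DependsOn (fun σ : Config d q =>
      (posterior α (likelihood M (k + 1) v σ) s - α s) ^ 2) (descendants (k + 1) v) :=
    fun k ξ ξ' h => by simp only [dependsOn_likelihood (k + 1) v h]
  have hK : 0 ≤ ∑ t, symEntropyReal α (posterior α fun s => M s t) :=
    Finset.sum_nonneg fun t _ => symEntropyReal_nonneg hα hα_pos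
      (posterior_mem hα hα_pos fun s => hM_pos s t) (posterior_pos hα hα_pos fun s => hM_pos s t)
  have hsum : Summable fun k => ∫ σ, (posterior α (likelihood M (k + 1) v σ) s - α s) ^ 2 ∂P := by
    refine Summable.of_nonneg_of_le (fun k => integral_nonneg fun σ => sq_nonneg _) (fun k => ?_)
      ((hd (height v)).mul_left (∑ t, symEntropyReal α (posterior α fun s => M s t)))
    have h1 : ∀ σ : Config d q, (posterior α (likelihood M (k + 1) v σ) s - α s) ^ 2 ≤
        symEntropyReal α (posterior α (likelihood M (k + 1) v σ)) := by
      intro σ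
      have hZ := likelihood_succ_pos hM_pos k v σ
      exact (Finset.single_le_sum
        (f := fun i => (posterior α (likelihood M (k + 1) v σ) i - α i) ^ 2)
        (fun i _ => sq_nonneg _) (Finset.mem_univ s)).trans (sum_sq_le_symEntropyReal hα hα_pos
          (posterior_mem hα hα_pos hZ) (posterior_pos hα hα_pos hZ))
    refine (integral_mono (integrable_of_dependsOn (hdep k))
      (integrable_symEntropyReal_posterior hP _ _) h1).trans
      ((integral_symEntropyReal_posterior_le hP hM_pos hM_row hα hα_inv hc k v).trans ?_)
    refine mul_le_mul_of_nonneg_left (mul_le_mul_of_nonneg_left ?_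
      (pow_nonneg ENNReal.toReal_nonneg k)) hK
    exact_mod_cast Finset.card_le_card (descendants_subset_level (k + 1) v)
  filter_upwards [ae_tendsto_zero_of_summable_integral
    (fun k => integrable_of_dependsOn (hdep k)) (fun k σ => sq_nonneg _) hsum] with σ hσ
  rw [← tendsto_add_atTop_iff_nat 1]
  have h2 : Tendsto (fun k => |posterior α (likelihood M (k + 1) v σ) s - α s|) atTop (𝓝 0) := by
    have h3 := (Real.continuous_sqrt.tendsto 0).comp hσ
    simpa [Function.comp_def, Real.sqrt_sq_eq_abs] using h3
  exact tendsto_iff_norm_sub_tendsto_zero.2 h2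

theorem cond_agreeOn_measureReal (A : Set (Vertex d)) (ξ : Config d q) (E : Set (Config d q)) :
    (P[|agreeOn A ξ]).real E = P.real (agreeOn A ξ ∩ E) / P.real (agreeOn A ξ) := by
  rw [measureReal_def, cond_apply (measurableSet_agreeOn _ _), ENNReal.toReal_mul,
    ENNReal.toReal_inv, ← measureReal_def, ← measureReal_def, inv_mul_eq_div]

theorem cond_measureReal_agreeOn_level (hP : IsTreeChain M α d P) (hM_pos : ∀ i j, 0 < M i j)
    (hα : ∀ i, 0 < α i) (n k : ℕ) (η ξ : Config d q) :
    (P[|agreeOn (level d (n + k)) ξ]).real (agreeOn (ball d n) η) =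
      (P.real (agreeOn (ball d n) η) * ∏ v ∈ level d n, likelihood M k v ξ (η v)) /
        ∫ σ, ∏ v ∈ level d n, likelihood M k v ξ (σ v) ∂P := by
  have := hP.isProb
  have hmem : ∀ v ∈ level d n, v ∈ (ball d n : Set (Vertex d)) := fun v hv => by
    simpa using (mem_level.1 hv).le
  have hE := measurableSet_agreeOn (ball d n : Set (Vertex d)) η
  have hdep := dependsOn_indicator (dependsOn_mem_agreeOn (ball d n : Set (Vertex d)) η)
  have h1 := setIntegral_agreeOn_level hP hM_pos hα hdep k ξ
  have h2 := setIntegral_agreeOn_level hP hM_pos hα (n := n) (F := fun _ => 1)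
    (fun _ _ _ => rfl) k ξ
  simp only [one_mul, setIntegral_const, smul_eq_mul, mul_one] at h2
  rw [integral_indicator hE, setIntegral_const, smul_eq_mul, mul_one,
    measureReal_restrict_apply hE] at h1
  rw [cond_agreeOn_measureReal, ← h2, Set.inter_comm, h1]
  congr 1
  calc ∫ σ, (agreeOn (ball d n) η).indicator (fun _ => 1) σ *
        ∏ v ∈ level d n, likelihood M k v ξ (σ v) ∂P =
      ∫ σ in agreeOn (ball d n) η, ∏ v ∈ level d n, likelihood M k v ξ (σ v) ∂P := by
        rw [← integral_indicator hE]
        refine integral_congr_ae (ae_of_all _ fun σ => ?_)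
        simp only [indicator_eq_mul _ fun σ => ∏ v ∈ level d n, likelihood M k v ξ (σ v), mul_comm]
    _ = ∫ σ in agreeOn (ball d n) η, ∏ v ∈ level d n, likelihood M k v ξ (η v) ∂P :=
        setIntegral_congr_fun hE fun σ hσ =>
          Finset.prod_congr rfl fun v hv => by rw [hσ v (hmem v hv)]
    _ = _ := by rw [setIntegral_const, smul_eq_mul]

/-- The spins in a ball become independent of the spins at a distant level. -/
theorem ae_tendsto_cond_level (hP : IsTreeChain M α d P)
    (hM_pos : ∀ i j, 0 < M i j) (hM_row : ∀ i, ∑ j, M i j = 1) (hα : α ∈ stdSimplex ℝ (Fin q))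
    (hα_inv : α ᵥ* M = α) (hc : entropyConst α M ≠ ∞)
    (hd : ∀ n, Summable fun k => (entropyConst α M).toReal ^ k * (level d (n + (k + 1))).card)
    (n : ℕ) (η : Config d q) :
    ∀ᵐ ξ ∂P, Tendsto (fun N => (P[|agreeOn (level d N) ξ]).real (agreeOn (ball d n) η)) atTop
      (𝓝 (P.real (agreeOn (ball d n) η))) := by
  have := hP.isProb
  have hα_pos := invariant_pos hM_pos hα hα_inv
  filter_upwards [ae_tendsto_posterior hP hM_pos hM_row hα hα_inv hc hd] with ξ hξ
  rw [← tendsto_add_atTop_iff_nat (n + 1)]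
  -- Division of the likelihoods by `c k v` turns them into densities of posterior laws.
  set c : ℕ → Vertex d → ℝ := fun k v => ∑ t, α t * likelihood M (k + 1) v ξ t
  have hc_pos : ∀ k v, 0 < c k v := fun k v =>
    sum_prior_mul_pos hα hα_pos (likelihood_succ_pos hM_pos k v ξ)
  have hlim : ∀ v s, Tendsto (fun k => likelihood M (k + 1) v ξ s / c k v) atTop (𝓝 1) := by
    intro v s
    have h1 := ((tendsto_add_atTop_iff_nat 1).2 (hξ v s)).div_const (α s)
    rw [div_self (hα_pos s).ne'] at h1
    refine h1.congr fun k => ?_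
    rw [posterior, mul_comm (α s), div_right_comm, mul_div_cancel_right₀ _ (hα_pos s).ne']
  have hprod : ∀ σ : Config d q, Tendsto
      (fun k => ∏ v ∈ level d n, likelihood M (k + 1) v ξ (σ v) / c k v) atTop (𝓝 1) := by
    intro σ
    have h1 := tendsto_finsetProd (level d n) fun v _ => hlim v (σ v)
    simpa using h1
  have hmem : ∀ v ∈ level d n, v ∈ (ball d n : Set (Vertex d)) := fun v hv => by
    simpa using (mem_level.1 hv).le
  have hint : Tendsto
      (fun k => ∫ σ, ∏ v ∈ level d n, likelihood M (k + 1) v ξ (σ v) / c k v ∂P) atTop (𝓝 1) := by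
    have h1 : ∀ k, ∫ σ, ∏ v ∈ level d n, likelihood M (k + 1) v ξ (σ v) / c k v ∂P =
        ∑ x : ball d n → Fin q, (∏ v ∈ level d n, likelihood M (k + 1) v ξ
          (patch (ball d n) x ξ v) / c k v) *
            P.real (Set.univ ∩ agreeOn (ball d n) (patch (ball d n) x ξ)) := by
      intro k
      rw [← setIntegral_univ]
      exact setIntegral_eq_sum ξ _ (dependsOn_prod fun v hv =>
        dependsOn_apply (hmem v hv) fun s => likelihood M (k + 1) v ξ s / c k v)
    simp only [h1]
    have h2 : (1 : ℝ) = ∑ x : ball d n → Fin q,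
        1 * P.real (Set.univ ∩ agreeOn (ball d n) (patch (ball d n) x ξ)) := by
      simp only [one_mul]
      rw [← measureReal_eq_sum (ball d n) ξ MeasurableSet.univ, probReal_univ]
    rw [congrArg 𝓝 h2]
    exact tendsto_finsetSum _ fun x _ => (hprod _).mul_const _
  have h3 := ((hprod η).const_mul (P.real (agreeOn (ball d n) η))).div hint one_ne_zero
  rw [mul_one, div_one] at h3
  refine h3.congr fun k => ?_
  rw [show k + (n + 1) = n + (k + 1) by ring, cond_measureReal_agreeOn_level hP hM_pos hα_pos]
  simp only [Pi.div_apply, Finset.prod_div_distrib]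
  rw [integral_div, mul_div_assoc', div_div_div_cancel_right₀]
  exact (Finset.prod_pos fun v _ => hc_pos k v).ne'

theorem noReconstruction (hP : IsTreeChain M α d P)
    (hM_pos : ∀ i j, 0 < M i j) (hM_row : ∀ i, ∑ j, M i j = 1) (hα : α ∈ stdSimplex ℝ (Fin q))
    (hα_inv : α ᵥ* M = α) (hc : entropyConst α M ≠ ∞)
    (hd : ∀ n, Summable fun k => (entropyConst α M).toReal ^ k * (level d (n + (k + 1))).card) :
    NoReconstruction α P := by
  intro s ε hε
  have := hP.isProb
  have hα_pos := invariant_pos hM_pos hα hα_inv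
  have h1 : {σ : Config d q | σ (root d) = s} = agreeOn (ball d 0) fun _ => s := by
    ext σ
    simp only [agreeOn, Set.mem_ofPred_eq, Finset.mem_coe, mem_ball, Nat.le_zero, height_eq_zero,
      forall_eq]
  have h2 : P.real {σ : Config d q | σ (root d) = s} = α s := by
    have h0 : nonRootBall d 0 = ∅ := by
      rw [Finset.eq_empty_iff_forall_notMem]
      intro w hw
      rw [mem_nonRootBall, ne_eq, ← height_eq_zero] at hw
      omega
    rw [h1, measureReal_agreeOn_ball hP hM_pos hα_pos, h0, Finset.prod_empty, mul_one]
  have h3 := ae_tendsto_cond_level hP hM_pos hM_row hα hα_inv hc hd 0 fun _ => s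
  rw [← h1, h2] at h3
  have h4 : ∀ N, DependsOn (fun ξ : Config d q =>
      (P[|agreeOn (level d N) ξ]).real {σ : Config d q | σ (root d) = s}) (level d N) :=
    fun N ξ ξ' h => by simp only [agreeOn_congr h]
  have h5 := tendstoInMeasure_of_tendsto_ae
    (fun N => (measurable_of_dependsOn (h4 N)).aestronglyMeasurable) h3
  rw [tendstoInMeasure_iff_norm] at h5
  simpa only [coe_level, Real.norm_eq_abs] using h5 ε hε

end Decay

/-! ### The chain is a Gibbs measure -/

section Gibbs

variable {d : List ℕ → ℕ} {q : ℕ} {M : Matrix (Fin q) (Fin q) ℝ} {α : Fin q → ℝ}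
  {P : Measure (Config d q)}

theorem IsChild.height_eq {v w : Vertex d} (h : IsChild v w) : height w = height v + 1 := by
  obtain ⟨k, hk⟩ := h
  simp [height, hk]

theorem outerBoundary_subset_ball {V : Finset (Vertex d)} {n : ℕ} (h : V ⊆ ball d n) :
    outerBoundary (V : Set (Vertex d)) ⊆ ball d (n + 1) := by
  rintro w ⟨-, v, hv, hvw⟩
  have h1 := mem_ball.1 (h hv)
  rw [Finset.mem_coe, mem_ball]
  rcases hvw with h2 | h2 <;> have := h2.height_eq <;> omega

theorem outerBoundary_ball (N : ℕ) :
    outerBoundary (ball d N : Set (Vertex d)) = level d (N + 1) := by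
  ext w
  simp only [outerBoundary, Set.mem_ofPred_eq, Finset.mem_coe, mem_ball, mem_level]
  constructor
  · rintro ⟨hw, v, hv, h | h⟩ <;> have := h.height_eq <;> omega
  · intro hw
    have hne : w ≠ root d := fun h => by rw [h, height_root] at hw; omega
    exact ⟨by omega, parent w, by rw [height_parent]; omega, Or.inl (isChild_parent hne)⟩

/-- The weight of a configuration on the ball of radius `N` splits into the factors that involve
`V` and the others. -/
theorem exists_weight_factorization (hM_pos : ∀ i j, 0 < M i j) (hα : ∀ i, 0 < α i)
    (V : Finset (Vertex d)) (N : ℕ) : ∃ f g : Config d q → ℝ, (∀ σ, 0 < f σ) ∧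
      DependsOn f ((V : Set (Vertex d)) ∪ outerBoundary V) ∧ DependsOn g (V : Set (Vertex d))ᶜ ∧
      ∀ σ, α (σ (root d)) * ∏ w ∈ nonRootBall d N, M (σ (parent w)) (σ w) = f σ * g σ := by
  refine ⟨fun σ => (if root d ∈ V then α (σ (root d)) else 1) *
      ∏ w ∈ nonRootBall d N with w ∈ V ∨ parent w ∈ V, M (σ (parent w)) (σ w),
    fun σ => (if root d ∈ V then 1 else α (σ (root d))) *
      ∏ w ∈ nonRootBall d N with ¬ (w ∈ V ∨ parent w ∈ V), M (σ (parent w)) (σ w),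
    fun σ => mul_pos ?_ (Finset.prod_pos fun w _ => hM_pos _ _), fun σ σ' h => ?_,
    fun σ σ' h => ?_, fun σ => ?_⟩
  · split_ifs
    exacts [hα _, one_pos]
  · dsimp only
    congr 1
    · split_ifs with h0
      · rw [h _ (Or.inl h0)]
      · rfl
    · refine Finset.prod_congr rfl fun w hw => ?_
      obtain ⟨hw1, hw2⟩ := Finset.mem_filter.1 hw
      have hc := isChild_parent (mem_nonRootBall.1 hw1).1
      have h1 : w ∈ (V : Set (Vertex d)) ∪ outerBoundary V := by
        by_cases h3 : w ∈ V
        · exact Or.inl h3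
        · exact Or.inr ⟨h3, parent w, hw2.resolve_left h3, Or.inl hc⟩
      have h2 : parent w ∈ (V : Set (Vertex d)) ∪ outerBoundary V := by
        by_cases h3 : parent w ∈ V
        · exact Or.inl h3
        · exact Or.inr ⟨h3, w, hw2.resolve_right h3, Or.inr hc⟩
      rw [h _ h1, h _ h2]
  · dsimp only
    congr 1
    · split_ifs with h0
      · rfl
      · rw [h _ h0]
    · refine Finset.prod_congr rfl fun w hw => ?_
      have hw2 := not_or.1 (Finset.mem_filter.1 hw).2
      rw [h _ hw2.1, h _ hw2.2]
  · rw [← Finset.prod_filter_mul_prod_filter_not (nonRootBall d N)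
      (fun w => w ∈ V ∨ parent w ∈ V)]
    split_ifs <;> ring

/-- The elementary conditional probability given the outer boundary of `V` is a version of the
conditional probability given the spins in any larger finite set outside `V`. -/
theorem setIntegral_agreeOn_eq_integral_cond (hP : IsTreeChain M α d P)
    (hM_pos : ∀ i j, 0 < M i j) (hα : ∀ i, 0 < α i) (V : Finset (Vertex d)) (η : Config d q)
    {D : Finset (Vertex d)} (hD : (D : Set (Vertex d)) ⊆ (V : Set (Vertex d))ᶜ)
    {φ : Config d q → ℝ} (hφ : DependsOn φ D) :
    ∫ σ in agreeOn V η, φ σ ∂P =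
      ∫ σ, (P[|agreeOn (outerBoundary (V : Set (Vertex d))) σ]).real (agreeOn V η) * φ σ ∂P := by
  have := hP.isProb
  obtain ⟨n, hn⟩ := exists_subset_ball (V ∪ D)
  have hVB : V ⊆ ball d (n + 1) :=
    (Finset.subset_union_left.trans hn).trans (ball_mono n.le_succ)
  have hDB : D ⊆ ball d (n + 1) :=
    (Finset.subset_union_right.trans hn).trans (ball_mono n.le_succ)
  have hbd := outerBoundary_subset_ball (Finset.subset_union_left.trans hn)
  obtain ⟨f, g, hf_pos, hf, hg, hfg⟩ := exists_weight_factorization hM_pos hα V (n + 1)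
  have hpatch : ∀ x (ξ : Config d q), agreeOn (ball d (n + 1) \ V : Finset (Vertex d)) ξ ∩
      agreeOn V (patch V x ξ) = agreeOn (ball d (n + 1)) (patch V x ξ) := by
    intro x ξ
    rw [← agreeOn_congr (η := patch V x ξ), ← agreeOn_union, ← Finset.coe_union,
      Finset.sdiff_union_of_subset hVB]
    intro v hv
    exact patch_of_notMem (Finset.mem_sdiff.1 hv).2
  have hweight : ∀ x (ξ : Config d q), P.real (agreeOn (ball d (n + 1)) (patch V x ξ)) =
      f (patch V x ξ) * g ξ := by
    intro x ξ
    rw [measureReal_agreeOn_ball hP hM_pos hα, hfg]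
    congr 1
    exact hg fun v hv => patch_of_notMem hv
  set r : Config d q → ℝ := fun ξ =>
    f (patch V (spinsOn V η) ξ) / ∑ x : V → Fin q, f (patch V x ξ) with hr
  have hr_dep : DependsOn r (outerBoundary V) := by
    intro ξ ξ' h
    have h1 : ∀ x, f (patch V x ξ) = f (patch V x ξ') := fun x => hf fun v hv => by
      by_cases hvV : v ∈ V
      · rw [patch_of_mem hvV, patch_of_mem hvV]
      · rw [patch_of_notMem hvV, patch_of_notMem hvV, h v (hv.resolve_left hvV)]
    simp only [hr, h1]
  have hbd' : outerBoundary (V : Set (Vertex d)) ⊆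
      (ball d (n + 1) \ V : Finset (Vertex d)) := fun v hv =>
    Finset.mem_sdiff.2 ⟨hbd hv, hv.1⟩
  have hD' : (D : Set (Vertex d)) ⊆ (ball d (n + 1) \ V : Finset (Vertex d)) := fun v hv =>
    Finset.mem_sdiff.2 ⟨hDB hv, hD hv⟩
  have key : ∀ ξ, P.real (agreeOn (ball d (n + 1) \ V : Finset (Vertex d)) ξ ∩ agreeOn V η) =
      r ξ * P.real (agreeOn (ball d (n + 1) \ V : Finset (Vertex d)) ξ) := by
    intro ξ
    have h1 : agreeOn (V : Set (Vertex d)) η = agreeOn V (patch V (spinsOn V η) ξ) :=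
      agreeOn_congr fun v hv => (patch_of_mem (x := spinsOn V η) hv).symm
    have h2 : 0 < ∑ x : V → Fin q, f (patch V x ξ) :=
      Finset.sum_pos (fun x _ => hf_pos _) ⟨spinsOn V η, Finset.mem_univ _⟩
    rw [measureReal_eq_sum V ξ (measurableSet_agreeOn _ ξ), h1]
    simp only [hpatch, hweight]
    rw [← Finset.sum_mul, hr]
    field_simp [h2.ne']
  have hcond : ∀ ξ, (P[|agreeOn (outerBoundary (V : Set (Vertex d))) ξ]).real (agreeOn V η) =
      r ξ := by
    intro ξ
    have hB := measurableSet_agreeOn (outerBoundary (V : Set (Vertex d))) ξ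
    have h1 := setIntegral_eq_integral_mul (dependsOn_of_subset hr_dep hbd')
      (dependsOn_of_subset (dependsOn_indicator
        (dependsOn_mem_agreeOn (outerBoundary (V : Set (Vertex d))) ξ)) hbd') key
    simp only [← indicator_eq_mul] at h1
    rw [integral_indicator hB, integral_indicator hB, setIntegral_const, smul_eq_mul, mul_one,
      measureReal_restrict_apply hB, setIntegral_congr_fun (g := fun _ => r ξ) hB
        (fun σ hσ => hr_dep fun v hv => hσ v hv), setIntegral_const, smul_eq_mul] at h1
    have h2 : 0 < P.real (agreeOn (outerBoundary (V : Set (Vertex d))) ξ) :=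
      (measureReal_agreeOn_pos hP hM_pos hα (ball d (n + 1)) ξ).trans_le
        (measureReal_mono fun σ hσ v hv => hσ v (hbd hv))
    rw [cond_agreeOn_measureReal, h1, mul_div_cancel_left₀ _ h2.ne']
  simp only [hcond]
  exact setIntegral_eq_integral_mul (dependsOn_of_subset hr_dep hbd') (dependsOn_of_subset hφ hD')
    key

theorem dependsOn_cond (A : Set (Vertex d)) (E : Set (Config d q)) :
    DependsOn (fun σ : Config d q => (P[|agreeOn A σ]).real E) A := fun σ σ' h => by
  simp only [agreeOn_congr h]

theorem exists_coe_eq_outerBoundary (V : Finset (Vertex d)) :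
    ∃ B : Finset (Vertex d), (B : Set (Vertex d)) = outerBoundary V := by
  obtain ⟨n, hn⟩ := exists_subset_ball V
  exact ((ball d (n + 1)).finite_toSet.subset (outerBoundary_subset_ball hn)).exists_finset_coe

theorem measurable_cylinderEvents_of_dependsOn {A : Finset (Vertex d)} {Δ : Set (Vertex d)}
    (hA : (A : Set (Vertex d)) ⊆ Δ) {f : Config d q → ℝ} (hf : DependsOn f A) :
    Measurable[cylinderEvents Δ] f := by
  obtain ⟨f', rfl⟩ := exists_eq_comp_restrict hf
  have h : Measurable[cylinderEvents Δ] (spinsOn A : Config d q → A → Fin q) :=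
    (@measurable_pi_iff _ _ _ (cylinderEvents Δ) _ _).2 fun v =>
      measurable_cylinderEvent_apply (hA v.2)
  exact (Measurable.of_discrete (f := f')).comp h

theorem mem_gibbsMeasures (hP : IsTreeChain M α d P) (hM_pos : ∀ i j, 0 < M i j)
    (hα : ∀ i, 0 < α i) : P ∈ gibbsMeasures P := by
  have := hP.isProb
  refine ⟨hP.isProb, fun V η => ?_⟩
  obtain ⟨B, hB⟩ := exists_coe_eq_outerBoundary V
  set g : Config d q → ℝ := fun σ =>
    (P[|agreeOn (outerBoundary (V : Set (Vertex d))) σ]).real (agreeOn V η)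
  have hg_dep : DependsOn g B := hB ▸ dependsOn_cond _ _
  have hg_int : Integrable g P := integrable_of_dependsOn hg_dep
  have hBV : (B : Set (Vertex d)) ⊆ (V : Set (Vertex d))ᶜ := hB ▸ fun v hv => hv.1
  have hE := measurableSet_agreeOn (V : Set (Vertex d)) η
  -- It suffices to compare two measures on the cylinder sets outside `V`.
  set C : Set (Set (Config d q)) := {s | ∃ D : Finset (Vertex d),
    (D : Set (Vertex d)) ⊆ (V : Set (Vertex d))ᶜ ∧ DependsOn (fun σ : Config d q => σ ∈ s) D}
  have hC_meas : ∀ s ∈ C, MeasurableSet s := by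
    rintro s ⟨D, -, hs⟩
    exact measurableSet_setOfPred.2 (measurable_of_dependsOn hs)
  have hC_pi : IsPiSystem C := by
    rintro s ⟨D, hD, hs⟩ t ⟨D', hD', ht⟩ -
    refine ⟨D ∪ D', by rw [Finset.coe_union]; exact Set.union_subset hD hD', fun σ σ' h => ?_⟩
    rw [Finset.coe_union] at h
    exact congrArg₂ And (hs fun v hv => h v (Or.inl hv)) (ht fun v hv => h v (Or.inr hv))
  have hC_le : cylinderEvents (V : Set (Vertex d))ᶜ ≤ MeasurableSpace.generateFrom C := by
    refine iSup₂_le fun v hv => ?_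
    rintro _ ⟨t, -, rfl⟩
    refine MeasurableSpace.measurableSet_generateFrom ⟨{v}, by simpa using hv, fun σ σ' h => ?_⟩
    simp [h v (by simp)]
  have hν2 : ∀ s, MeasurableSet s → P.withDensity (fun σ => ENNReal.ofReal (g σ)) s =
      ENNReal.ofReal (∫ σ in s, g σ ∂P) := by
    intro s hs
    rw [withDensity_apply _ hs, ofReal_integral_eq_lintegral_ofReal hg_int.integrableOn
      (ae_of_all _ fun σ => measureReal_nonneg)]
  have hCeq : ∀ s ∈ C, P.restrict (agreeOn V η) s =
      P.withDensity (fun σ => ENNReal.ofReal (g σ)) s := by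
    intro s hs
    have hs' := hC_meas s hs
    obtain ⟨D, hD, hsD⟩ := hs
    have h1 : ∫ σ in agreeOn V η, s.indicator (fun _ => 1) σ ∂P =
        ∫ σ, g σ * s.indicator (fun _ => 1) σ ∂P :=
      setIntegral_agreeOn_eq_integral_cond hP hM_pos hα V η hD (dependsOn_indicator hsD)
    simp only [← indicator_eq_mul] at h1
    rw [integral_indicator hs', integral_indicator hs', setIntegral_const, smul_eq_mul,
      mul_one] at h1
    rw [hν2 s hs', ← h1, ofReal_measureReal]
  have hm : cylinderEvents (V : Set (Vertex d))ᶜ ≤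
    (MeasurableSpace.pi : MeasurableSpace (Config d q)) := cylinderEvents_le_pi
  have huniv : Set.univ ∈ C := ⟨∅, by simp, fun _ _ _ => rfl⟩
  have heq : ∀ s, MeasurableSet[cylinderEvents (V : Set (Vertex d))ᶜ] s →
      P.real (s ∩ agreeOn V η) = ∫ σ in s, g σ ∂P := by
    intro s hs
    have h1 := ext_on_measurableSpace_of_generate_finite MeasurableSpace.pi C hCeq
      (MeasurableSpace.generateFrom_le hC_meas) rfl hC_pi (hCeq _ huniv) (hC_le _ hs)
    rw [hν2 s (hm _ hs), Measure.restrict_apply (hm _ hs)] at h1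
    rw [measureReal_def, h1, ENNReal.toReal_ofReal (integral_nonneg fun σ => measureReal_nonneg)]
  refine (ae_eq_condExp_of_forall_setIntegral_eq hm ((integrable_const 1).indicator hE)
    (fun s _ _ => hg_int.integrableOn) (fun s hs _ => ?_) ?_).symm
  · rw [← heq s hs, setIntegral_indicator hE, setIntegral_const, smul_eq_mul, mul_one]
  · exact (measurable_cylinderEvents_of_dependsOn hBV hg_dep).stronglyMeasurable.aestronglyMeasurable

/-! ### Extremality -/

/-- A Gibbs measure is an average of the conditional probabilities of the chain, given the spins at
a distant level. -/
theorem measureReal_agreeOn_ball_of_mem_gibbsMeasures (hP : IsTreeChain M α d P)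
    (hM_pos : ∀ i j, 0 < M i j) (hα : ∀ i, 0 < α i) {μ : Measure (Config d q)}
    (hμ : μ ∈ gibbsMeasures P) {n N : ℕ} (hN : n ≤ N) (η : Config d q) :
    μ.real (agreeOn (ball d n) η) =
      ∫ σ, (P[|agreeOn (level d (N + 1)) σ]).real (agreeOn (ball d n) η) ∂μ := by
  have := hμ.1
  have := hP.isProb
  have hE := measurableSet_agreeOn (ball d n : Set (Vertex d)) η
  have hfin : ∀ ξ : Config d q, IsProbabilityMeasure (P[|agreeOn (level d (N + 1)) ξ]) :=
    fun ξ => cond_isProbabilityMeasure fun h => by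
      have h1 := measureReal_agreeOn_pos hP hM_pos hα (level d (N + 1)) ξ
      rw [measureReal_def, h, ENNReal.toReal_zero] at h1
      exact h1.false
  have h1 : ∀ ζ : Config d q, μ.real (agreeOn (ball d N) ζ) =
      ∫ σ, (P[|agreeOn (level d (N + 1)) σ]).real (agreeOn (ball d N) ζ) ∂μ := by
    intro ζ
    have hm : cylinderEvents (ball d N : Set (Vertex d))ᶜ ≤
      (MeasurableSpace.pi : MeasurableSpace (Config d q)) := cylinderEvents_le_pi
    have h2 := hμ.2 (ball d N) ζ
    rw [outerBoundary_ball] at h2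
    rw [← integral_congr_ae h2, integral_condExp hm,
      integral_indicator (measurableSet_agreeOn _ _), setIntegral_const, smul_eq_mul, mul_one]
  have h3 : ∀ ζ : Config d q, agreeOn (ball d n : Set (Vertex d)) η ∩ agreeOn (ball d N) ζ = ∅ ∨
      agreeOn (ball d n : Set (Vertex d)) η ∩ agreeOn (ball d N) ζ = agreeOn (ball d N) ζ := by
    intro ζ
    have hsub : (ball d n : Set (Vertex d)) ⊆ ball d N := Finset.coe_subset.2 (ball_mono hN)
    by_cases hζ : ζ ∈ agreeOn (ball d n : Set (Vertex d)) η
    · refine Or.inr (Set.inter_eq_right.2 fun σ hσ v hv => ?_)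
      rw [hσ v (hsub hv), hζ v hv]
    · refine Or.inl (Set.eq_empty_of_forall_notMem fun σ hσ => hζ fun v hv => ?_)
      rw [← hσ.2 v (hsub hv), hσ.1 v hv]
  simp only [measureReal_eq_sum (ball d N) η hE]
  rw [integral_finsetSum]
  · refine Finset.sum_congr rfl fun x _ => ?_
    rcases h3 (patch (ball d N) x η) with h4 | h4
    · simp [h4]
    · rw [h4, h1]
  · exact fun x _ => integrable_of_dependsOn (dependsOn_cond _ _)

/-- Gibbs measures that are absolutely continuous with respect to the chain coincide with it,
since the conditional probabilities given a distant level converge almost surely. -/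
theorem mem_extremePoints_gibbsMeasures (hP : IsTreeChain M α d P)
    (hM_pos : ∀ i j, 0 < M i j) (hα : ∀ i, 0 < α i)
    (h : ∀ n η, ∀ᵐ ξ ∂P,
      Tendsto (fun N => (P[|agreeOn (level d N) ξ]).real (agreeOn (ball d n) η)) atTop
        (𝓝 (P.real (agreeOn (ball d n) η)))) :
    P ∈ (gibbsMeasures P).extremePoints ℝ≥0 := by
  refine ⟨mem_gibbsMeasures hP hM_pos hα, fun μ hμ μ' _ hseg => ?_⟩
  obtain ⟨a, b, ha, -, -, hab⟩ := hseg
  have := hP.isProb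
  have := hμ.1
  have hac : μ ≪ P := by
    refine Measure.AbsolutelyContinuous.mk fun s _ hs => ?_
    rw [← hab, Measure.add_apply, Measure.smul_apply, add_eq_zero] at hs
    have h1 : (a : ℝ≥0∞) * μ s = 0 := hs.1
    exact (mul_eq_zero.1 h1).resolve_left (by simpa using ha.ne')
  refine measure_ext_of_ball fun n η => ?_
  rw [← coe_ball]
  refine (measureReal_eq_measureReal_iff).1 ?_
  have hdep : ∀ N, DependsOn (fun ξ : Config d q =>
      (P[|agreeOn (level d N) ξ]).real (agreeOn (ball d n) η)) (level d N) :=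
    fun N => dependsOn_cond _ _
  have hlim := tendsto_integral_of_dominated_convergence (μ := μ) (fun _ => (1 : ℝ))
    (F := fun N ξ => (P[|agreeOn (level d N) ξ]).real (agreeOn (ball d n) η))
    (fun N => (measurable_of_dependsOn (hdep N)).aestronglyMeasurable) (integrable_const 1)
    (fun N => ae_of_all _ fun ξ => by
      rw [Real.norm_eq_abs, abs_of_nonneg measureReal_nonneg, cond_agreeOn_measureReal]
      exact div_le_one_of_le₀ (measureReal_mono Set.inter_subset_left) measureReal_nonneg)
    (hac.ae_le (h n η))
  rw [integral_const, probReal_univ, one_smul] at hlim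
  refine tendsto_nhds_unique (tendsto_const_nhds.congr' ?_) hlim
  filter_upwards [eventually_gt_atTop n] with N hN
  obtain ⟨N, rfl⟩ : ∃ m, N = m + 1 := ⟨N - 1, by omega⟩
  exact measureReal_agreeOn_ball_of_mem_gibbsMeasures hP hM_pos hα hμ (Nat.lt_succ_iff.1 hN) η

end Gibbs

/-! ### The growth of Galton-Watson trees -/

section GaltonWatson

variable {ν : PMF ℕ}

instance : IsProbabilityMeasure (galtonWatson ν) := by
  unfold galtonWatson
  infer_instance

theorem isVertex_cons_eq_pi {v : List ℕ} {I : Finset (List ℕ)} {t : List ℕ → Set ℕ}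
    (hv : v ∉ I) (ht : {d | IsVertex d v} = Set.pi I t) (k : ℕ) :
    {d | IsVertex d (k :: v)} =
      Set.pi (insert v I : Finset (List ℕ)) (Function.update t v (Set.Ioi k)) := by
  ext d
  have h1 : IsVertex d v ↔ ∀ u ∈ I, d u ∈ t u := by
    have := Set.ext_iff.1 ht d
    simpa using this
  simp only [Set.mem_ofPred_eq, IsVertex, h1, Set.mem_pi, Finset.mem_coe,
    Finset.forall_mem_insert, Function.update_self, Set.mem_Ioi]
  refine and_congr_right fun _ => forall₂_congr fun u hu => ?_
  rw [Function.update_of_ne (ne_of_mem_of_not_mem hu hv)]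

/-- A word is a vertex if and only if the offspring numbers of its proper suffixes are large
enough. -/
theorem exists_isVertex_eq_pi (v : List ℕ) : ∃ (I : Finset (List ℕ)) (t : List ℕ → Set ℕ),
    (∀ u ∈ I, u.length < v.length) ∧ {d | IsVertex d v} = Set.pi I t := by
  induction v with
  | nil => exact ⟨∅, fun _ => Set.univ, by simp, by ext d; simp [IsVertex]⟩
  | cons k v ih =>
    obtain ⟨I, t, hI, ht⟩ := ih
    refine ⟨insert v I, _, fun u hu => ?_,
      isVertex_cons_eq_pi (fun h => (hI v h).false) ht k⟩
    rcases Finset.mem_insert.1 hu with rfl | hu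
    · simp
    · exact (hI u hu).trans (by simp)

theorem measurableSet_isVertex (v : List ℕ) : MeasurableSet {d | IsVertex d v} := by
  obtain ⟨I, t, -, ht⟩ := exists_isVertex_eq_pi v
  rw [ht]
  exact MeasurableSet.pi I.countable_toSet fun _ _ => .of_discrete

theorem galtonWatson_isVertex_cons (k : ℕ) (v : List ℕ) :
    galtonWatson ν {d | IsVertex d (k :: v)} =
      ν.toMeasure (Set.Ioi k) * galtonWatson ν {d | IsVertex d v} := by
  obtain ⟨I, t, hI, ht⟩ := exists_isVertex_eq_pi v
  have hv : v ∉ I := fun h => (hI v h).false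
  rw [isVertex_cons_eq_pi hv ht, ht, galtonWatson, Measure.infinitePi_pi _ fun _ _ => .of_discrete,
    Measure.infinitePi_pi _ fun _ _ => .of_discrete, Finset.prod_insert hv, Function.update_self]
  congr 1
  refine Finset.prod_congr rfl fun u hu => ?_
  rw [Function.update_of_ne (ne_of_mem_of_not_mem hu hv)]

/-- The mean as the sum of the tail probabilities. -/
theorem tsum_toMeasure_Ioi (ν : PMF ℕ) : ∑' k, ν.toMeasure (Set.Ioi k) = offspringMean ν := by
  have h1 : ∀ k, ν.toMeasure (Set.Ioi k) = ∑' n, if k < n then ν n else 0 := by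
    intro k
    rw [PMF.toMeasure_apply _ .of_discrete]
    simp [Set.indicator_apply]
  simp only [h1]
  rw [ENNReal.tsum_comm, offspringMean]
  refine tsum_congr fun n => ?_
  rw [tsum_eq_sum (s := Finset.range n) fun k hk => if_neg (by simpa using hk),
    Finset.sum_congr rfl fun k hk => if_pos (Finset.mem_range.1 hk)]
  simp [mul_comm]

theorem tsum_galtonWatson_isVertex (N : ℕ) :
    ∑' v : List ℕ, (if v.length = N then galtonWatson ν {d | IsVertex d v} else 0) =
      offspringMean ν ^ N := by
  induction N with
  | zero =>
    rw [tsum_eq_single [] fun v hv => if_neg (by simpa using hv)]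
    simp [IsVertex]
  | succ N ih =>
    have hinj : Function.Injective fun p : ℕ × List ℕ => p.1 :: p.2 := by
      rintro ⟨k, v⟩ ⟨k', v'⟩ h
      simpa using h
    rw [← hinj.tsum_eq]
    · rw [ENNReal.tsum_prod', pow_succ', ← ih, ← tsum_toMeasure_Ioi, ← ENNReal.tsum_mul_right]
      refine tsum_congr fun k => ?_
      rw [← ENNReal.tsum_mul_left]
      refine tsum_congr fun v => ?_
      simp only [List.length_cons, Nat.add_right_cancel_iff, galtonWatson_isVertex_cons, mul_ite,
        mul_zero]
    · intro v hv
      cases v with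
      | nil => simp at hv
      | cons k v => exact ⟨(k, v), rfl⟩

theorem card_level_eq_tsum (d : List ℕ → ℕ) (N : ℕ) : ((level d N).card : ℝ≥0∞) =
    ∑' v : List ℕ, {d | IsVertex d v}.indicator (fun _ => if v.length = N then 1 else 0) d := by
  rw [← Subtype.val_injective.tsum_eq (g := (Subtype.val : Vertex d → List ℕ)),
    tsum_eq_sum (s := level d N)]
  · rw [Finset.sum_congr rfl (g := fun _ => 1)]
    · simp
    · exact fun v hv => (Set.indicator_of_mem (s := {d | IsVertex d v.1}) v.2 _).trans
        (if_pos (mem_level.1 hv))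
  · exact fun v hv => (Set.indicator_of_mem (s := {d | IsVertex d v.1}) v.2 _).trans
      (if_neg (mt mem_level.2 hv))
  · exact fun v hv => ⟨⟨v, Set.mem_of_indicator_ne_zero (s := {d | IsVertex d v}) hv⟩, rfl⟩

theorem measurable_card_level (N : ℕ) :
    Measurable fun d : List ℕ → ℕ => ((level d N).card : ℝ≥0∞) := by
  simp only [card_level_eq_tsum]
  exact Measurable.tsum fun v => measurable_const.indicator (measurableSet_isVertex v)

theorem lintegral_card_level (N : ℕ) :
    ∫⁻ d, ((level d N).card : ℝ≥0∞) ∂(galtonWatson ν) = offspringMean ν ^ N := by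
  simp only [card_level_eq_tsum]
  rw [lintegral_tsum fun v =>
    (measurable_const.indicator (measurableSet_isVertex v)).aemeasurable,
    ← tsum_galtonWatson_isVertex]
  refine tsum_congr fun v => ?_
  rw [lintegral_indicator_const (measurableSet_isVertex v)]
  split_ifs <;> simp

/-- The generations of a subcritically weighted Galton-Watson tree are summable. For `c = 0` the
mean may be infinite, but then all terms but the first vanish. -/
theorem ae_summable_pow_mul_card_level {c : ℝ≥0∞} (hc : c ≠ ∞) (h : offspringMean ν * c < 1) :
    ∀ᵐ d ∂(galtonWatson ν), ∀ n,
      Summable fun k => c.toReal ^ k * ((level d (n + (k + 1))).card : ℝ) := by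
  rcases eq_or_ne c 0 with rfl | hc0
  · refine ae_of_all _ fun d n => summable_of_ne_finset_zero (s := {0}) fun k hk => ?_
    rw [ENNReal.toReal_zero, zero_pow (by simpa using hk), zero_mul]
  rw [ae_all_iff]
  intro n
  have hm : offspringMean ν ≠ ∞ := fun hm => by
    rw [hm, ENNReal.top_mul hc0] at h
    exact not_top_lt h
  have hmeas : ∀ k, Measurable fun d : List ℕ → ℕ =>
      c ^ k * ((level d (n + (k + 1))).card : ℝ≥0∞) := fun k =>
    (measurable_card_level _).const_mul _
  have h1 : ∫⁻ d, ∑' k, c ^ k * ((level d (n + (k + 1))).card : ℝ≥0∞) ∂(galtonWatson ν) ≠ ∞ := by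
    rw [lintegral_tsum fun k => (hmeas k).aemeasurable]
    have h2 : ∀ k, ∫⁻ d, c ^ k * ((level d (n + (k + 1))).card : ℝ≥0∞) ∂(galtonWatson ν) =
        offspringMean ν ^ (n + 1) * (offspringMean ν * c) ^ k := by
      intro k
      rw [lintegral_const_mul _ (measurable_card_level _), lintegral_card_level]
      ring
    simp only [h2]
    rw [ENNReal.tsum_mul_left, ENNReal.tsum_geometric]
    exact ENNReal.mul_ne_top (ENNReal.pow_ne_top hm)
      (ENNReal.inv_ne_top.2 (tsub_pos_of_lt h).ne')
  filter_upwards [ae_lt_top (Measurable.tsum hmeas) h1] with d hd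
  refine (ENNReal.summable_toReal hd.ne).congr fun k => ?_
  rw [ENNReal.toReal_mul, ENNReal.toReal_pow, ENNReal.toReal_natCast]

theorem one_le_offspringMean (hν : ν 0 = 0) : 1 ≤ offspringMean ν := by
  rw [← ν.tsum_coe, offspringMean]
  refine ENNReal.tsum_le_tsum fun k => ?_
  rcases Nat.eq_zero_or_pos k with rfl | hk
  · simp [hν]
  · exact le_mul_of_one_le_right' (by exact_mod_cast hk)

end GaltonWatson

end TreeBroadcast

/-- Let `M` be a stochastic matrix with positive entries and invariant law `α`, and let `ν` be an
offspring law on `{1, 2, …}`. If the mean offspring number times `c(M)` is less than `1`, then, for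
almost every Galton-Watson tree, the tree-indexed Markov chain `P` in equilibrium (which exists and
is unique) is an extreme point of the set of its Gibbs measures, and there is no reconstruction. -/
theorem theorem1 (q : ℕ) (M : Matrix (Fin q) (Fin q) ℝ) (hM_pos : ∀ i j, 0 < M i j)
    (hM_row : ∀ i, ∑ j, M i j = 1) (α : Fin q → ℝ) (hα : α ∈ stdSimplex ℝ (Fin q))
    (hα_inv : α ᵥ* M = α) (ν : PMF ℕ) (hν : ν 0 = 0)
    (hc : offspringMean ν * entropyConst α M < 1) :
    ∀ᵐ d ∂(galtonWatson ν),
      (∃! P : Measure (Config d q), IsTreeChain M α d P) ∧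
      ∀ P : Measure (Config d q), IsTreeChain M α d P →
        P ∈ (gibbsMeasures P).extremePoints ℝ≥0 ∧ NoReconstruction α P := by
  have hα_pos := invariant_pos hM_pos hα hα_inv
  have hc' : entropyConst α M ≠ ∞ := fun h => by
    rw [h, ENNReal.mul_top (one_pos.trans_le (one_le_offspringMean hν)).ne'] at hc
    exact not_top_lt hc
  filter_upwards [ae_summable_pow_mul_card_level hc' hc] with d hd
  refine ⟨?_, fun P hP => ⟨mem_extremePoints_gibbsMeasures hP hM_pos hα_pos
    (ae_tendsto_cond_level hP hM_pos hM_row hα hα_inv hc' hd),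
    noReconstruction hP hM_pos hM_row hα hα_inv hc' hd⟩⟩
  obtain ⟨P, hP⟩ := exists_isTreeChain hM_pos hM_row hα d
  exact ⟨P, hP, fun P' hP' => hP'.unique hP⟩
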